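/- For a non-negative integer $\eta$, a finite graph is $\eta$-balanced if the numbers of vertices of any two of its connected components differ by at most $\eta$; it is a cluster graph if each of its connected components is a clique. An instance of Balanced Cluster Editing is a triple $(G,k,\eta)$ of a finite simple graph $G$ and non-negative integers $k,\eta$. It is a yes-instance if there is a set $F\subseteq\binom{V(G)}{2}$ with $|F|\le k$ such that $G\triangle F$, the graph with vertex set $V(G)$ and edge set $(E(G)\setminus F)\cup(F\setminus E(G))$, is an $\eta$-balanced cluster graph. Theorem. Balanced Cluster Editing, parameterized by $k$, admits a kernel with $O(k^3)$ vertices. That is, there are a constant $C$ and an algorithm that, given an instance $(G,k,\eta)$, runs in time polynomial in the length of the input (the adjacency matrix of $G$, and $|V(G)|$, $k$ and $\eta$ in binary) and outputs an instance $(G',k',\eta')$ such that $(G',k',\eta')$ is a yes-instance if and only if $(G,k,\eta)$ is one, and $$|V(G')|\le C(k+1)^3,\qquad k'\le k,\qquad \eta'\le C(k+1)^3 .$$ Here the algorithm is a program for a random access machine with addition and truncated subtraction, without multiplication, with unit cost for each operation. -/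

import Mathlib

/-! ### Balanced cluster graphs -/

namespace BalancedCluster

/-- A cluster graph: every connected component is a clique. -/
def IsClusterGraph {V : Type*} (G : SimpleGraph V) : Prop :=
  ∀ c : G.ConnectedComponent, G.IsClique c.supp

/-- The sizes (numbers of vertices) of any two connected components differ by at most `η`. -/
def IsBalanced {V : Type*} (G : SimpleGraph V) (η : ℕ) : Prop :=
  ∀ c d : G.ConnectedComponent, c.supp.ncard ≤ d.supp.ncard + η

/-- The graph `G △ F`, with the same vertices as `G` and edge set `E(G) △ F`. -/
def edit {V : Type*} (G : SimpleGraph V) (F : Set (Sym2 V)) : SimpleGraph V :=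
  SimpleGraph.fromEdgeSet (symmDiff G.edgeSet F)

/-- `F` is a set of at most `k` unordered pairs of distinct vertices such that
`G △ F` is an `η`-balanced cluster graph. -/
def IsSolution {V : Type*} (G : SimpleGraph V) (k η : ℕ) (F : Finset (Sym2 V)) : Prop :=
  (∀ e ∈ F, ¬ e.IsDiag) ∧ F.card ≤ k ∧
    IsClusterGraph (edit G (F : Set (Sym2 V))) ∧ IsBalanced (edit G (F : Set (Sym2 V))) η

/-- An instance of Balanced Cluster Editing; the vertices are numbered `0, …, n - 1`. -/
structure Instance where
  /-- the number of vertices -/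
  n : ℕ
  /-- the graph -/
  graph : SimpleGraph (Fin n)
  /-- the budget, which is the parameter -/
  k : ℕ
  /-- the permitted difference of component sizes -/
  η : ℕ

/-- `I` is a yes-instance of Balanced Cluster Editing. -/
def Instance.IsYes (I : Instance) : Prop :=
  ∃ F : Finset (Sym2 (Fin I.n)), IsSolution I.graph I.k I.η F

/-- The length of the input in bits: an adjacency matrix, and `n`, `k`, `η` in binary. -/
def Instance.size (I : Instance) : ℕ :=
  I.n ^ 2 + Nat.size I.n + Nat.size I.k + Nat.size I.η

end BalancedCluster

/-! ### A random access machine with a step count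

Programs are built from assignments, conditionals and loops over numbered registers and numbered
one-dimensional arrays of natural numbers. The arithmetic operations are addition and truncated
subtraction (there is no multiplication), so that the number of steps is polynomially related
to the running time of a Turing machine. -/

namespace RAM

/-- A configuration: the contents of the registers, and of the cells of the arrays. -/
structure State where
  /-- `reg x` is the content of register `x` -/
  reg : ℕ → ℕ
  /-- `arr a i` is the content of cell `i` of array `a` -/
  arr : ℕ → ℕ → ℕ

/-- Expressions. -/
inductive Expr where
  | const (c : ℕ)
  | reg (x : ℕ)
  | load (a : ℕ) (i : Expr)
  | add (e f : Expr)
  | sub (e f : Expr)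
  | le (e f : Expr)

/-- The value of an expression. -/
def Expr.eval (s : State) : Expr → ℕ
  | .const c => c
  | .reg x => s.reg x
  | .load a i => s.arr a (i.eval s)
  | .add e f => e.eval s + f.eval s
  | .sub e f => e.eval s - f.eval s
  | .le e f => if e.eval s ≤ f.eval s then 1 else 0

/-- The number of elementary operations in the evaluation of an expression. -/
def Expr.cost : Expr → ℕ
  | .const _ => 1
  | .reg _ => 1
  | .load _ i => i.cost + 1
  | .add e f => e.cost + f.cost + 1
  | .sub e f => e.cost + f.cost + 1
  | .le e f => e.cost + f.cost + 1

/-- Programs. `assign x e` is `x := e`, and `store a i e` is `a[i] := e`.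
The test of a `cond` or a `loop` succeeds when the value of its expression is not `0`. -/
inductive Prog where
  | skip
  | assign (x : ℕ) (e : Expr)
  | store (a : ℕ) (i e : Expr)
  | seq (p q : Prog)
  | cond (e : Expr) (p q : Prog)
  | loop (e : Expr) (p : Prog)

/-- The configuration after `x := v`. -/
def State.setReg (s : State) (x v : ℕ) : State :=
  { s with reg := Function.update s.reg x v }

/-- The configuration after `a[i] := v`. -/
def State.setArr (s : State) (a i v : ℕ) : State :=
  { s with arr := Function.update s.arr a (Function.update (s.arr a) i v) }

/-- `Exec p s t s'`: started in `s`, the program `p` halts in `s'` after exactly `t` steps. -/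
inductive Exec : Prog → State → ℕ → State → Prop where
  | skip (s : State) : Exec .skip s 1 s
  | assign (x : ℕ) (e : Expr) (s : State) :
      Exec (.assign x e) s (e.cost + 1) (s.setReg x (e.eval s))
  | store (a : ℕ) (i e : Expr) (s : State) :
      Exec (.store a i e) s (i.cost + e.cost + 1) (s.setArr a (i.eval s) (e.eval s))
  | seq {p q : Prog} {s s' s'' : State} {t t' : ℕ} :
      Exec p s t s' → Exec q s' t' s'' → Exec (.seq p q) s (t + t') s''
  | cond_true {e : Expr} {p : Prog} (q : Prog) {s s' : State} {t : ℕ} :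
      e.eval s ≠ 0 → Exec p s t s' → Exec (.cond e p q) s (e.cost + 1 + t) s'
  | cond_false {e : Expr} (p : Prog) {q : Prog} {s s' : State} {t : ℕ} :
      e.eval s = 0 → Exec q s t s' → Exec (.cond e p q) s (e.cost + 1 + t) s'
  | loop_true {e : Expr} {p : Prog} {s s' s'' : State} {t t' : ℕ} :
      e.eval s ≠ 0 → Exec p s t s' → Exec (.loop e p) s' t' s'' →
        Exec (.loop e p) s (e.cost + 1 + t + t') s''
  | loop_false {e : Expr} (p : Prog) {s : State} :
      e.eval s = 0 → Exec (.loop e p) s (e.cost + 1) s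

end RAM

namespace BalancedCluster

/-- The registers `0`, `1`, `2` contain `n`, `k`, `η`, and the first `n ^ 2` cells of array `0`
contain the adjacency matrix, row by row. -/
def Instance.StoredIn (I : Instance) (s : RAM.State) : Prop :=
  s.reg 0 = I.n ∧ s.reg 1 = I.k ∧ s.reg 2 = I.η ∧
    ∀ u v : Fin I.n, (I.graph.Adj u v → s.arr 0 (u * I.n + v) = 1) ∧
      (¬ I.graph.Adj u v → s.arr 0 (u * I.n + v) = 0)

open Classical in
/-- The initial configuration on input `I`: it stores `I`, and everything else is `0`. -/
noncomputable def Instance.init (I : Instance) : RAM.State where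
  reg x := if x = 0 then I.n else if x = 1 then I.k else if x = 2 then I.η else 0
  arr a i :=
    if a = 0 ∧ ∃ u v : Fin I.n, i = u * I.n + v ∧ I.graph.Adj u v then 1 else 0

/-- The program `P` is a polynomial-time algorithm that turns every instance `I` of
Balanced Cluster Editing into an equivalent instance `J` such that `bound I J` holds. -/
def IsPolyTimeReduction (P : RAM.Prog) (bound : Instance → Instance → Prop) : Prop :=
  ∃ p : Polynomial ℕ, ∀ I : Instance, ∃ (J : Instance) (t : ℕ) (s : RAM.State),
    RAM.Exec P I.init t s ∧ t ≤ p.eval I.size ∧ J.StoredIn s ∧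
      (J.IsYes ↔ I.IsYes) ∧ bound I J

/-- Balanced Cluster Editing, parameterized by `k`, admits a kernel in which the number of
vertices and the number `η` are at most `g k`, and the parameter does not increase. -/
def AdmitsKernel (g : ℕ → ℕ) : Prop :=
  ∃ P : RAM.Prog, IsPolyTimeReduction P fun I J => J.n ≤ g I.k ∧ J.k ≤ I.k ∧ J.η ≤ g I.k

end BalancedCluster

/-!
Write `A` for the relation "adjacent or equal". A solution amounts to an equivalence relation `r`,
the clusters, that differs from `A` in at most `2 * k` ordered pairs and whose classes have sizes
that differ by at most `η` (`exists_isSolution_iff`). In particular it touches at most `2 * k`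
vertices. All of the reduction rests on this.

*Normalization.* A vertex `v` with more than `2 * k` true twins is never touched
(`IsSol.forced`), so its cluster is its closed neighbourhood in every solution. The edits that
isolate all these forced clusters are contained in every solution. They are carried out at
once and paid from the budget (`Instance.isYes_iff_nadj`). Conversely, a class with more than `4 * k`
vertices contains an untouched vertex with more than `2 * k` twins. So after the
normalization the classes of a solution with more than `4 * k` vertices are exactly the isolated
cliques of that size, and vertices outside isolated cliques lie in at most `2 * k` touched
classes of at most `4 * k` vertices each, which bounds their number by `8 * k ^ 2`.

*Large isolated cliques.* They only matter through the balance condition. If there are other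
vertices, then these are in classes with at most `4 * k` vertices, so that the maximum size `M` gives
the strongest condition. The large cliques are replaced by one with `4 * k + 1` vertices, and
`η` is decreased by `M - (4 * k + 1)` (`Instance.exists_isSol_shrunk_iff`).

*Small isolated cliques.* For each size `s ≤ 4 * k`, the first `2 * k + 1` vertices in isolated
cliques of size `s` are marked, and the cliques without a marked vertex are deleted
(`Instance.exists_isSol_kept_iff`). A solution leaves a marked vertex untouched, so the clique of
that vertex can be exchanged with the clique to be deleted (`exists_isSol_delete_iff`). What
remains has `O(k ^ 3)` vertices, and `η` may be capped at this number.

*Running time.* All of the above is defined from the input by counting and by quantifying over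
vertices, with bounded nesting and without iteration. Functions with such definitions are computed
in polynomial time by loops over the vertices; the closure properties are proved for programs in the
section on `Computable`, and they apply to each of the definitions in turn.
-/

/-! ### Solutions as equivalence relations -/

namespace BalancedCluster

open Finset Classical

section Relations

variable {V : Type*}

/-- `r` is a solution for the reflexive symmetric relation `A` (adjacency or equality) on the
vertex set `W`: an equivalence relation that differs from `A` in at most `K` ordered pairs, and
whose classes, inside `W`, have sizes that differ by at most `η`. -/
structure IsSol (W : Finset V) (A : V → V → Prop) (K η : ℕ) (r : V → V → Prop) : Prop where
  equiv : Equivalence r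
  cost : #{p ∈ W ×ˢ W | ¬ (A p.1 p.2 ↔ r p.1 p.2)} ≤ K
  bal : ∀ u ∈ W, ∀ v ∈ W, #{w ∈ W | r u w} ≤ #{w ∈ W | r v w} + η

/-- The closed neighbourhood relation of a graph: adjacent or equal. -/
def cadj (G : SimpleGraph V) (u v : V) : Prop := u = v ∨ G.Adj u v

theorem cadj_refl (G : SimpleGraph V) (u : V) : cadj G u u := Or.inl rfl

theorem cadj_symm (G : SimpleGraph V) {u v : V} (h : cadj G u v) : cadj G v u :=
  h.imp Eq.symm SimpleGraph.Adj.symm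

theorem card_adj_pairs [Fintype V] (X : SimpleGraph V) [Fintype X.edgeSet]
    [DecidablePred fun p : V × V => X.Adj p.1 p.2] :
    #{p : V × V | X.Adj p.1 p.2} = 2 * #X.edgeFinset := by
  trans 2 * #(@SimpleGraph.edgeFinset V X (SimpleGraph.fintypeEdgeSet X))
  swap
  · congr!
  rw [← X.sum_degrees_eq_twice_card_edges, ← univ_product_univ, card_filter, sum_product]
  refine sum_congr rfl fun u _ => ?_
  rw [← card_filter, ← X.card_neighborFinset_eq_degree]
  congr 1
  ext v
  simp

theorem reachable_iff_of_adj_iff {H : SimpleGraph V} {r : V → V → Prop} (hr : Equivalence r)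
    (h : ∀ u v, H.Adj u v ↔ u ≠ v ∧ r u v) (u v : V) : H.Reachable u v ↔ r u v := by
  constructor
  · rintro ⟨p⟩
    induction p with
    | nil => exact hr.refl _
    | cons hadj _ ih => exact hr.trans ((h _ _).1 hadj).2 ih
  · intro huv
    by_cases e : u = v
    · rw [e]
    · exact SimpleGraph.Adj.reachable ((h _ _).2 ⟨e, huv⟩)

theorem ncard_supp [Fintype V] (H : SimpleGraph V) (u : V)
    [DecidablePred (H.Reachable u)] :
    (H.connectedComponentMk u).supp.ncard = #{w | H.Reachable u w} := by
  rw [← Set.ncard_coe_finset]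
  congr 1
  ext w
  simp [SimpleGraph.reachable_comm]

theorem edit_adj (G : SimpleGraph V) (F : Set (Sym2 V)) (u v : V) :
    (edit G F).Adj u v ↔ u ≠ v ∧ ¬ (G.Adj u v ↔ s(u, v) ∈ F) := by
  simp only [edit, SimpleGraph.fromEdgeSet_adj, Set.mem_symmDiff, SimpleGraph.mem_edgeSet]
  tauto

theorem exists_isSolution_iff [Fintype V] (G : SimpleGraph V) (k η : ℕ) :
    (∃ F, IsSolution G k η F) ↔ ∃ r, IsSol univ (cadj G) (2 * k) η r := by
  constructor
  · rintro ⟨F, hd, hk, hc, hb⟩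
    set H := edit G (F : Set (Sym2 V)) with hH
    have hadj : ∀ u v, H.Adj u v ↔ u ≠ v ∧ H.Reachable u v := by
      refine fun u v => ⟨fun h => ⟨h.ne, h.reachable⟩, fun h => ?_⟩
      refine hc (H.connectedComponentMk u) ?_ ?_ h.1
      · simp
      · simpa using h.2.symm
    refine ⟨H.Reachable, H.reachable_is_equivalence, ?_, fun u _ v _ => ?_⟩
    · have key : ∀ p : V × V, ¬ (cadj G p.1 p.2 ↔ H.Reachable p.1 p.2) →
          (SimpleGraph.fromEdgeSet (F : Set (Sym2 V))).Adj p.1 p.2 := by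
        rintro ⟨u, v⟩ h
        simp only at h ⊢
        have hne : u ≠ v := by
          rintro rfl
          exact h (iff_of_true (cadj_refl _ _) (SimpleGraph.Reachable.refl _))
        have h1 := hadj u v
        rw [hH, edit_adj, ← hH] at h1
        simp only [SimpleGraph.fromEdgeSet_adj]
        unfold cadj at h
        tauto
      have hF : #(SimpleGraph.fromEdgeSet (F : Set (Sym2 V))).edgeFinset ≤ k := by
        refine le_trans (card_le_card fun e he => ?_) hk
        rw [SimpleGraph.mem_edgeFinset, SimpleGraph.edgeSet_fromEdgeSet] at he
        exact he.1
      have := card_adj_pairs (SimpleGraph.fromEdgeSet (F : Set (Sym2 V)))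
      refine le_trans (card_le_card (t := ({p : V × V |
        (SimpleGraph.fromEdgeSet (F : Set (Sym2 V))).Adj p.1 p.2} : Finset _)) fun p hp => ?_)
        (by omega)
      simp only [mem_filter, mem_univ, true_and] at hp ⊢
      exact key p hp.2
    · rw [← ncard_supp, ← ncard_supp]
      exact hb _ _
  · rintro ⟨r, hr, hcost, hbal⟩
    let X : SimpleGraph V :=
      { Adj := fun u v => ¬ (cadj G u v ↔ r u v)
        symm := ⟨fun u v h => by
          rwa [show cadj G v u ↔ cadj G u v from ⟨cadj_symm G, cadj_symm G⟩,
            show r v u ↔ r u v from ⟨hr.symm, hr.symm⟩]⟩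
        loopless := ⟨fun u h => h (iff_of_true (cadj_refl _ _) (hr.refl _))⟩ }
    have hX : ∀ u v, X.Adj u v ↔ ¬ (cadj G u v ↔ r u v) := fun _ _ => Iff.rfl
    have hadj : ∀ u v, (edit G (X.edgeFinset : Set (Sym2 V))).Adj u v ↔ u ≠ v ∧ r u v := by
      intro u v
      rw [edit_adj]
      refine and_congr_right fun hne => ?_
      rw [SimpleGraph.coe_edgeFinset, SimpleGraph.mem_edgeSet, hX]
      unfold cadj
      tauto
    have hreach := reachable_iff_of_adj_iff hr hadj
    refine ⟨X.edgeFinset, fun e he => ?_, ?_, fun c => ?_, fun c d => ?_⟩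
    · exact X.not_isDiag_of_mem_edgeSet (SimpleGraph.mem_edgeFinset.1 he)
    · have := card_adj_pairs X
      have h2 : #{p : V × V | X.Adj p.1 p.2} ≤ 2 * k := by
        simpa [hX] using hcost
      omega
    · intro u hu v hv hne
      rw [hadj]
      refine ⟨hne, ?_⟩
      rw [← hreach]
      exact SimpleGraph.ConnectedComponent.exact
        ((SimpleGraph.ConnectedComponent.mem_supp_iff _ _).1 hu |>.trans
          ((SimpleGraph.ConnectedComponent.mem_supp_iff _ _).1 hv).symm)
    · induction c using SimpleGraph.ConnectedComponent.ind with | _ u => ?_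
      induction d using SimpleGraph.ConnectedComponent.ind with | _ v => ?_
      rw [ncard_supp, ncard_supp]
      simp only [hreach]
      exact hbal u (mem_univ _) v (mem_univ _)

end Relations

end BalancedCluster

namespace BalancedCluster

open Finset Classical

/-! ### General facts about solutions -/

section General

variable {V V' : Type*}

/-- Solutions are transported along bijections. -/
theorem IsSol.comap {W : Finset V} {W' : Finset V'} {A : V → V → Prop} {A' : V' → V' → Prop}
    {K η : ℕ} {r : V → V → Prop} (h : IsSol W A K η r) (φ : V' → V) (hφ : Set.BijOn φ W' W)
    (hA : ∀ u ∈ W', ∀ v ∈ W', (A' u v ↔ A (φ u) (φ v))) :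
    IsSol W' A' K η (fun u v => r (φ u) (φ v)) := by
  have hcls : ∀ u, #{w ∈ W' | r (φ u) (φ w)} = #{w ∈ W | r (φ u) w} := by
    intro u
    refine card_bij (fun w _ => φ w) ?_ ?_ ?_
    · intro w hw
      rw [mem_filter] at hw ⊢
      exact ⟨hφ.mapsTo hw.1, hw.2⟩
    · intro w hw w' hw' e
      exact hφ.injOn (mem_filter.1 hw).1 (mem_filter.1 hw').1 e
    · intro w hw
      rw [mem_filter] at hw
      obtain ⟨x, hx, rfl⟩ := hφ.surjOn hw.1
      exact ⟨x, mem_filter.2 ⟨hx, hw.2⟩, rfl⟩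
  refine ⟨⟨fun u => h.equiv.refl _, fun e => h.equiv.symm e,
    fun e e' => h.equiv.trans e e'⟩, ?_, fun u hu v hv => ?_⟩
  · refine le_trans (card_le_card_of_injOn (fun p => (φ p.1, φ p.2)) ?_ ?_) h.cost
    · rintro ⟨u, v⟩ hp
      simp only [coe_filter, mem_product, Set.mem_ofPred_eq] at hp ⊢
      refine ⟨⟨hφ.mapsTo hp.1.1, hφ.mapsTo hp.1.2⟩, ?_⟩
      rw [← hA u hp.1.1 v hp.1.2]
      exact hp.2
    · rintro ⟨u, v⟩ hp ⟨u', v'⟩ hp' e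
      simp only [coe_filter, mem_product, Set.mem_ofPred_eq, Prod.mk.injEq] at hp hp' e ⊢
      exact ⟨hφ.injOn hp.1.1 hp'.1.1 e.1, hφ.injOn hp.1.2 hp'.1.2 e.2⟩
  · rw [hcls, hcls]
    exact h.bal _ (hφ.mapsTo hu) _ (hφ.mapsTo hv)

variable {W : Finset V} {A : V → V → Prop} {K η : ℕ} {r : V → V → Prop}

theorem IsSol.mono {K' η' : ℕ} (h : IsSol W A K η r) (hK : K ≤ K') (hη : η ≤ η') :
    IsSol W A K' η' r :=
  ⟨h.equiv, h.cost.trans hK, fun u hu v hv => (h.bal u hu v hv).trans (by omega)⟩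

/-- The vertex `u` is in a pair of vertices of `W` on which `A` and `r` differ. -/
def Touched (W : Finset V) (A r : V → V → Prop) (u : V) : Prop :=
  ∃ w ∈ W, ¬ (A u w ↔ r u w)

/-- The vertices `u` and `v` have the same neighbours in `W`. -/
def TwinOn (W : Finset V) (A : V → V → Prop) (u v : V) : Prop :=
  ∀ w ∈ W, (A u w ↔ A v w)

/-- A solution touches at most `K` vertices. -/
theorem IsSol.card_touched_le (h : IsSol W A K η r) :
    #{u ∈ W | Touched W A r u} ≤ K := by
  refine le_trans (le_trans (card_le_card fun u hu => ?_)
    (card_image_le (f := Prod.fst))) h.cost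
  rw [mem_filter] at hu
  obtain ⟨hu, w, hw, hm⟩ := hu
  exact mem_image.2 ⟨(u, w), mem_filter.2 ⟨mem_product.2 ⟨hu, hw⟩, hm⟩, rfl⟩

/-- Among more than `K` vertices there is an untouched one. -/
theorem IsSol.exists_untouched (h : IsSol W A K η r) {P : Finset V} (hP : P ⊆ W) (hK : K < #P) :
    ∃ p ∈ P, ∀ w ∈ W, (A p w ↔ r p w) := by
  by_contra! hcon
  refine absurd h.card_touched_le (not_le.2 (hK.trans_le (card_le_card fun p hp => ?_)))
  obtain ⟨w, hw, hm⟩ := hcon p hp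
  refine mem_filter.2 ⟨hP hp, w, hw, ?_⟩
  tauto

/-- A vertex with more than `K` twins is untouched: if the pair `v`, `w` is changed, then
so is, for each twin `q` of `v`, one of the pairs `q`, `w` and `q`, `v`. -/
theorem IsSol.forced (h : IsSol W A K η r) {Q : Finset V} (hQ : Q ⊆ W) (hK : K < #Q) {v : V}
    (hv : v ∈ W) (hvv : A v v) (htw : ∀ q ∈ Q, TwinOn W A q v) :
    ∀ w ∈ W, (A v w ↔ r v w) := by
  by_contra! hcon
  obtain ⟨w, hw, hm⟩ := hcon
  obtain ⟨q, hq, hun⟩ := h.exists_untouched hQ hK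
  have h1 := hun w hw
  have h2 := hun v hv
  rw [htw q hq w hw] at h1
  rw [htw q hq v hv] at h2
  have h3 := h2.1 hvv
  have h4 : r q w ↔ r v w := ⟨fun e => h.equiv.trans (h.equiv.symm h3) e,
    fun e => h.equiv.trans h3 e⟩
  tauto

/-- A large class of a solution contains a vertex with many twins. -/
theorem IsSol.exists_twins (h : IsSol W A K η r) {u : V} (hu : 2 * K < #{w ∈ W | r u w}) :
    ∃ v ∈ W, r u v ∧ K < #{q ∈ W | TwinOn W A q v} := by
  set U : Finset V := {q ∈ W | r u q ∧ ¬ Touched W A r q} with hU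
  have hcard : #{w ∈ W | r u w} ≤ #U + #{u ∈ W | Touched W A r u} := by
    refine le_trans (card_le_card fun q hq => ?_) (card_union_le _ _)
    rw [mem_filter] at hq
    rw [mem_union, hU, mem_filter, mem_filter]
    by_cases ht : Touched W A r q
    · exact Or.inr ⟨hq.1, ht⟩
    · exact Or.inl ⟨hq.1, hq.2, ht⟩
  have hun : ∀ q ∈ U, ∀ w ∈ W, (A q w ↔ r q w) := by
    intro q hq w hw
    by_contra hm
    rw [hU, mem_filter] at hq
    exact hq.2.2 ⟨w, hw, hm⟩
  have hK := h.card_touched_le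
  have hUK : K < #U := by omega
  obtain ⟨v, hv⟩ := card_pos.1 (by omega : 0 < #U)
  have hv' := hun v hv
  rw [hU, mem_filter] at hv
  refine ⟨v, hv.1, hv.2.1, hUK.trans_le (card_le_card fun q hq => ?_)⟩
  have hq' := hun q hq
  rw [hU, mem_filter] at hq
  refine mem_filter.2 ⟨hq.1, fun w hw => ?_⟩
  rw [hq' w hw, hv' w hw]
  have hqv : r q v := h.equiv.trans (h.equiv.symm hq.2.1) hv.2.1
  exact ⟨fun e => h.equiv.trans (h.equiv.symm hqv) e, fun e => h.equiv.trans hqv e⟩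

theorem filter_class_eq (hr : Equivalence r) {L : V → Prop}
    (hL : ∀ u ∈ W, ∀ w ∈ W, L u → r u w → L w) {u : V} (hu : u ∈ W) (hLu : ¬ L u) :
    {w ∈ W.filter (¬ L ·) | r u w} = {w ∈ W | r u w} := by
  ext w
  simp only [mem_filter]
  exact ⟨fun e => ⟨e.1.1, e.2⟩,
    fun e => ⟨⟨e.1, fun hw => hLu (hL w e.1 u hu hw (hr.symm e.2))⟩, e.2⟩⟩

/-- A union of classes of a solution may be deleted. -/
theorem IsSol.delete (h : IsSol W A K η r) {L : V → Prop}
    (hL : ∀ u ∈ W, ∀ w ∈ W, L u → r u w → L w) : IsSol (W.filter (¬ L ·)) A K η r := by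
  refine ⟨h.equiv, ?_, fun u hu v hv => ?_⟩
  · refine le_trans (card_le_card ?_) h.cost
    refine filter_subset_filter _ (product_subset_product ?_ ?_) <;> exact filter_subset _ _
  · rw [mem_filter] at hu hv
    rw [filter_class_eq h.equiv hL hu.1 hu.2, filter_class_eq h.equiv hL hv.1 hv.2]
    exact h.bal u hu.1 v hv.1

/-- The relation that is `e` on the vertices with `L`, `r` on the others, and relates no
vertex with `L` to one without. -/
def glue (L : V → Prop) (e r : V → V → Prop) (u v : V) : Prop :=
  (L u ∧ L v ∧ e u v) ∨ (¬ L u ∧ ¬ L v ∧ r u v)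

theorem glue_equivalence {L : V → Prop} {e : V → V → Prop} (hr : Equivalence r)
    (h1 : ∀ u, L u → e u u) (h2 : ∀ u v, L u → L v → e u v → e v u)
    (h3 : ∀ u v w, L u → L v → L w → e u v → e v w → e u w) : Equivalence (glue L e r) := by
  refine ⟨fun u => ?_, fun {u v} h => ?_, fun {u v w} h h' => ?_⟩
  · by_cases hu : L u
    · exact Or.inl ⟨hu, hu, h1 u hu⟩
    · exact Or.inr ⟨hu, hu, hr.refl u⟩
  · rcases h with ⟨a, b, c⟩ | ⟨a, b, c⟩
    · exact Or.inl ⟨b, a, h2 _ _ a b c⟩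
    · exact Or.inr ⟨b, a, hr.symm c⟩
  · rcases h with ⟨a, b, c⟩ | ⟨a, b, c⟩ <;> rcases h' with ⟨a', b', c'⟩ | ⟨a', b', c'⟩
    · exact Or.inl ⟨a, b', h3 _ _ _ a b b' c c'⟩
    · exact absurd b a'
    · exact absurd a' b
    · exact Or.inr ⟨a, b', hr.trans c c'⟩

theorem glue_of_pos {L : V → Prop} {e : V → V → Prop} {u w : V} (hu : L u) :
    glue L e r u w ↔ L w ∧ e u w := by
  unfold glue; tauto

theorem glue_of_neg {L : V → Prop} {e : V → V → Prop} {u w : V} (hu : ¬ L u) :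
    glue L e r u w ↔ ¬ L w ∧ r u w := by
  unfold glue; tauto

/-- If no pair of `A` joins a vertex with `L` to one without, then gluing a relation that agrees
with `A` on the vertices with `L` to `r` on the others creates no new differences from `A`. -/
theorem glue_cost {L : V → Prop} {e : V → V → Prop} (hsymm : ∀ u v, A u v → A v u)
    (hL : ∀ u ∈ W, ∀ w ∈ W, L u → A u w → L w)
    (he : ∀ u ∈ W, ∀ w ∈ W, L u → L w → (A u w ↔ e u w)) :
    #{p ∈ W ×ˢ W | ¬ (A p.1 p.2 ↔ glue L e r p.1 p.2)} ≤
      #{p ∈ W.filter (¬ L ·) ×ˢ W.filter (¬ L ·) | ¬ (A p.1 p.2 ↔ r p.1 p.2)} := by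
  refine card_le_card ?_
  rintro ⟨u, v⟩ hp
  simp only [mem_filter, mem_product] at hp ⊢
  obtain ⟨⟨hu, hv⟩, hm⟩ := hp
  have h1 := hL u hu v hv
  have h2 := hL v hv u hu
  have h3 := hsymm u v
  have h4 := he u hu v hv
  unfold glue at hm
  tauto

end General

end BalancedCluster

namespace BalancedCluster

open Finset Classical

/-! ### Deleting surplus cliques -/

section Surplus

variable {V : Type*} {A : V → V → Prop} {K η : ℕ}

/-- An isolated clique, that of `q`, may be deleted if more than `K` of the other vertices lie in
isolated cliques of the same size. A solution leaves one of these untouched; exchanging it with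
the clique of `q` gives the forward direction, and for the converse it shows that one more class
of that size does no harm. -/
theorem exists_isSol_delete_iff {W : Finset V}
    (hsymm : ∀ u v, A u v → A v u) {q : V} (hq : q ∈ W) {P : Finset V}
    (hP : P ⊆ W.filter (¬ A q ·)) (hK : K < #P)
    (hqc : ∀ x ∈ W, A q x → ∀ w ∈ W, (A x w ↔ A q w))
    (hPc : ∀ p ∈ P, ∀ x ∈ W, A p x → ∀ w ∈ W, (A x w ↔ A p w))
    (hsz : ∀ p ∈ P, #{w ∈ W | A p w} = #{w ∈ W | A q w}) :
    (∃ r, IsSol W A K η r) ↔ ∃ r, IsSol (W.filter (¬ A q ·)) A K η r := by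
  have hdisj : ∀ p ∈ P, ∀ w ∈ W, A p w → ¬ A q w := by
    intro p hp w hw hpw hqw
    have hpq := (hPc p hp w hw hpw q hq).1 (hsymm _ _ hqw)
    exact (mem_filter.1 (hP hp)).2 (hsymm _ _ hpq)
  have hPW : P ⊆ W := hP.trans (filter_subset _ _)
  constructor
  · rintro ⟨r, h⟩
    obtain ⟨p, hp, hun⟩ := h.exists_untouched hPW hK
    have hpW := hPW hp
    have hdel : IsSol (W.filter (¬ A p ·)) A K η r := by
      refine h.delete fun u hu w hw hpu huw => ?_
      exact (hun w hw).2 (h.equiv.trans ((hun u hu).1 hpu) huw)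
    let e : {w ∈ W | A p w} ≃ {w ∈ W | A q w} := Finset.equivOfCardEq (hsz p hp)
    let φ : V → V := fun x => if hx : x ∈ W.filter (A p ·) then e ⟨x, hx⟩ else x
    have φpos : ∀ x ∈ W, A p x → φ x ∈ W ∧ A q (φ x) := by
      intro x hx hpx
      have hx' : x ∈ W.filter (A p ·) := mem_filter.2 ⟨hx, hpx⟩
      have : φ x = e ⟨x, hx'⟩ := dif_pos hx'
      rw [this]
      exact mem_filter.1 (e ⟨x, hx'⟩).2
    have φneg : ∀ x, ¬ A p x → φ x = x := by
      intro x hpx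
      exact dif_neg fun h => hpx (mem_filter.1 h).2
    refine ⟨_, hdel.comap φ ⟨?_, ?_, ?_⟩ ?_⟩
    · intro x hx
      rw [mem_coe, mem_filter] at hx ⊢
      by_cases hpx : A p x
      · obtain ⟨h1, h2⟩ := φpos x hx.1 hpx
        exact ⟨h1, fun h3 => hdisj p hp _ h1 h3 h2⟩
      · rw [φneg x hpx]
        exact ⟨hx.1, hpx⟩
    · intro x hx y hy hxy
      rw [mem_coe, mem_filter] at hx hy
      by_cases hpx : A p x <;> by_cases hpy : A p y
      · have hx' : x ∈ W.filter (A p ·) := mem_filter.2 ⟨hx.1, hpx⟩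
        have hy' : y ∈ W.filter (A p ·) := mem_filter.2 ⟨hy.1, hpy⟩
        have e1 : φ x = e ⟨x, hx'⟩ := dif_pos hx'
        have e2 : φ y = e ⟨y, hy'⟩ := dif_pos hy'
        rw [e1, e2] at hxy
        exact congrArg Subtype.val (e.injective (Subtype.ext hxy))
      · rw [φneg y hpy] at hxy
        exact absurd (hxy ▸ (φpos x hx.1 hpx).2) hy.2
      · rw [φneg x hpx] at hxy
        exact absurd (hxy ▸ (φpos y hy.1 hpy).2) hx.2
      · rwa [φneg x hpx, φneg y hpy] at hxy
    · intro y hy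
      rw [mem_coe, mem_filter] at hy
      by_cases hqy : A q y
      · have hy' : y ∈ W.filter (A q ·) := mem_filter.2 ⟨hy.1, hqy⟩
        obtain ⟨⟨x, hx⟩, hxe⟩ := e.surjective ⟨y, hy'⟩
        have hx2 := mem_filter.1 hx
        refine ⟨x, mem_coe.2 (mem_filter.2 ⟨hx2.1, hdisj p hp x hx2.1 hx2.2⟩), ?_⟩
        have : φ x = e ⟨x, hx⟩ := dif_pos hx
        rw [this, hxe]
      · exact ⟨y, mem_coe.2 (mem_filter.2 ⟨hy.1, hqy⟩), φneg y hy.2⟩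
    · intro u hu v hv
      rw [mem_filter] at hu hv
      by_cases hpu : A p u <;> by_cases hpv : A p v
      · obtain ⟨h1, h2⟩ := φpos u hu.1 hpu
        obtain ⟨h3, h4⟩ := φpos v hv.1 hpv
        exact iff_of_true ((hPc p hp u hu.1 hpu v hv.1).2 hpv) ((hqc _ h1 h2 _ h3).2 h4)
      · obtain ⟨h1, h2⟩ := φpos u hu.1 hpu
        rw [φneg v hpv, hPc p hp u hu.1 hpu v hv.1, hqc _ h1 h2 v hv.1]
        exact iff_of_false hpv hv.2
      · obtain ⟨h1, h2⟩ := φpos v hv.1 hpv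
        rw [φneg u hpu]
        refine iff_of_false (fun h => ?_) (fun h => ?_)
        · exact hpu ((hPc p hp v hv.1 hpv u hu.1).1 (hsymm _ _ h))
        · exact hu.2 ((hqc _ h1 h2 u hu.1).1 (hsymm _ _ h))
      · rw [φneg u hpu, φneg v hpv]
  · rintro ⟨r, h⟩
    obtain ⟨p, hp, hun⟩ := h.exists_untouched hP hK
    have hL : ∀ u ∈ W, ∀ w ∈ W, A q u → A u w → A q w :=
      fun u hu w hw hqu huw => (hqc u hu hqu w hw).1 huw
    have hsize : ∀ u ∈ W, ∃ u' ∈ W.filter (¬ A q ·),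
        #{w ∈ W | glue (A q) (fun _ _ => True) r u w} = #{w ∈ W.filter (¬ A q ·) | r u' w} := by
      intro u hu
      by_cases hqu : A q u
      · refine ⟨p, hP hp, ?_⟩
        trans #{w ∈ W | A q w}
        · congr 1
          refine filter_congr fun w hw => ?_
          rw [glue_of_pos hqu, and_true]
        rw [← hsz p hp]
        congr 1
        ext w
        simp only [mem_filter]
        refine ⟨fun h => ?_, fun h => ⟨h.1.1, ?_⟩⟩
        · have := hdisj p hp w h.1 h.2
          exact ⟨⟨h.1, this⟩, (hun w (mem_filter.2 ⟨h.1, this⟩)).1 h.2⟩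
        · exact (hun w (mem_filter.2 h.1)).2 h.2
      · refine ⟨u, mem_filter.2 ⟨hu, hqu⟩, ?_⟩
        rw [filter_filter]
        congr 1
        refine filter_congr fun w hw => ?_
        rw [glue_of_neg hqu]
    refine ⟨glue (A q) (fun _ _ => True) r, glue_equivalence h.equiv (fun _ _ => trivial)
      (fun _ _ _ _ _ => trivial) (fun _ _ _ _ _ _ _ _ => trivial),
      (glue_cost hsymm hL fun u hu w hw hqu hqw => ?_).trans h.cost, fun u hu v hv => ?_⟩
    · exact iff_of_true ((hqc u hu hqu w hw).2 hqw) trivial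
    · obtain ⟨u', hu', e⟩ := hsize u hu
      obtain ⟨v', hv', e'⟩ := hsize v hv
      rw [e, e']
      exact h.bal u' hu' v' hv'

/-- Deleting the isolated cliques outside `S`, if for each of them more than `K` vertices of `S`
lie in isolated cliques of the same size. -/
theorem exists_isSol_subset_iff (hrefl : ∀ u, A u u) (hsymm : ∀ u v, A u v → A v u)
    {S : Finset V} (W : Finset V) (hS : S ⊆ W)
    (hcl : ∀ u ∈ W, u ∉ S → ∀ x ∈ W, A u x → x ∉ S ∧ ∀ w ∈ W, (A x w ↔ A u w))
    (hP : ∀ u ∈ W, u ∉ S → ∃ P ⊆ S, K < #P ∧ ∀ p ∈ P,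
      (∀ x ∈ W, A p x → x ∈ S ∧ ∀ w ∈ W, (A x w ↔ A p w)) ∧
        #{w ∈ W | A p w} = #{w ∈ W | A u w}) :
    (∃ r, IsSol W A K η r) ↔ ∃ r, IsSol S A K η r := by
  induction hn : #W using Nat.strong_induction_on generalizing W with
  | _ n ih =>
    by_cases hWS : W ⊆ S
    · rw [subset_antisymm hWS hS]
    obtain ⟨q, hq, hqS⟩ := not_subset.1 hWS
    have hSW : S ⊆ W.filter (¬ A q ·) :=
      fun s hs => mem_filter.2 ⟨hS hs, fun h => (hcl q hq hqS s (hS hs) h).1 hs⟩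
    have hqd : ∀ u ∈ W.filter (¬ A q ·), u ∉ S → ∀ w ∈ W, A u w → ¬ A q w := by
      intro u hu huS w hw huw hqw
      rw [mem_filter] at hu
      exact hu.2 (hsymm _ _ (((hcl u hu.1 huS w hw huw).2 q hq).1 (hsymm _ _ hqw)))
    obtain ⟨P, hPS, hPK, hPc⟩ := hP q hq hqS
    rw [exists_isSol_delete_iff hsymm hq (hPS.trans hSW) hPK
      (fun x hx h => (hcl q hq hqS x hx h).2) (fun p hp x hx h => ((hPc p hp).1 x hx h).2)
      (fun p hp => (hPc p hp).2)]
    refine ih _ ?_ (W.filter (¬ A q ·)) hSW ?_ ?_ rfl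
    · rw [← hn]
      refine card_lt_card (Finset.ssubset_iff_subset_ne.2 ⟨filter_subset _ _, fun e => ?_⟩)
      rw [← e, mem_filter] at hq
      exact hq.2 (hrefl q)
    · intro u hu huS x hx hux
      obtain ⟨h1, h2⟩ := hcl u (mem_filter.1 hu).1 huS x (mem_filter.1 hx).1 hux
      exact ⟨h1, fun w hw => h2 w (mem_filter.1 hw).1⟩
    · intro u hu huS
      obtain ⟨P, hPS, hPK, hPc⟩ := hP u (mem_filter.1 hu).1 huS
      refine ⟨P, hPS, hPK, fun p hp => ⟨fun x hx hpx => ?_, ?_⟩⟩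
      · obtain ⟨h1, h2⟩ := (hPc p hp).1 x (mem_filter.1 hx).1 hpx
        exact ⟨h1, fun w hw => h2 w (mem_filter.1 hw).1⟩
      · have e1 : {w ∈ W.filter (¬ A q ·) | A p w} = {w ∈ W | A p w} := by
          rw [filter_filter]
          refine filter_congr fun w hw => and_iff_right_of_imp fun h => ?_
          exact (mem_filter.1 (hSW ((hPc p hp).1 w hw h).1)).2
        have e2 : {w ∈ W.filter (¬ A q ·) | A u w} = {w ∈ W | A u w} := by
          rw [filter_filter]
          exact filter_congr fun w hw => and_iff_right_of_imp (hqd u hu huS w hw)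
        rw [e1, e2]
        exact (hPc p hp).2

end Surplus

end BalancedCluster

namespace BalancedCluster

open Finset Classical

/-! ### Ranks in finite linear orders -/

section Rank

variable {α : Type*} [LinearOrder α]

theorem rank_injOn (P : Finset α) : Set.InjOn (fun x => #{y ∈ P | y < x}) P := by
  have key : ∀ x ∈ P, ∀ x', x < x' → #{y ∈ P | y < x} < #{y ∈ P | y < x'} := by
    intro x hx x' h
    refine card_lt_card ⟨fun y hy => ?_, fun hsub => ?_⟩
    · rw [mem_filter] at hy ⊢
      exact ⟨hy.1, hy.2.trans h⟩
    · have := hsub (mem_filter.2 ⟨hx, h⟩)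
      exact lt_irrefl _ (mem_filter.1 this).2
  intro x hx x' hx' e
  rcases lt_trichotomy x x' with h | h | h
  · exact absurd e (key x hx x' h).ne
  · exact h
  · exact absurd e (key x' hx' x h).ne'

theorem rank_image (P : Finset α) : P.image (fun x => #{y ∈ P | y < x}) = range #P := by
  refine eq_of_subset_of_card_le (fun i hi => ?_) ?_
  · obtain ⟨x, hx, rfl⟩ := mem_image.1 hi
    refine mem_range.2 (card_lt_card ⟨filter_subset _ _, fun hsub => ?_⟩)
    exact lt_irrefl _ (mem_filter.1 (hsub hx)).2
  · rw [card_image_of_injOn (rank_injOn P), card_range]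

theorem card_rank_lt (P : Finset α) (m : ℕ) :
    #{x ∈ P | #{y ∈ P | y < x} < m} = min #P m := by
  rw [← card_image_of_injOn ((rank_injOn P).mono (filter_subset _ _))]
  trans #(range (min #P m))
  swap
  · exact card_range _
  congr 1
  ext i
  have hi := congrArg (i ∈ ·) (rank_image P)
  simp only [mem_image, mem_filter, mem_range, lt_min_iff, eq_iff_iff] at hi ⊢
  rw [← hi]
  constructor
  · rintro ⟨x, ⟨hx, hm⟩, rfl⟩
    exact ⟨⟨x, hx, rfl⟩, hm⟩
  · rintro ⟨⟨x, hx, rfl⟩, hm⟩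
    exact ⟨x, ⟨hx, hm⟩, rfl⟩

end Rank

theorem card_pairs_eq_two_mul {n : ℕ} {R : Fin n → Fin n → Prop} (hs : ∀ u v, R u v → R v u)
    (hi : ∀ u, ¬ R u u) :
    #{p : Fin n × Fin n | R p.1 p.2} = 2 * ∑ u, #{w | u < w ∧ R u w} := by
  have h1 : #{p : Fin n × Fin n | R p.1 p.2} = ∑ u, #{w | R u w} := by
    rw [← univ_product_univ, card_filter, sum_product]
    exact sum_congr rfl fun u _ => (card_filter _ _).symm
  have h2 : ∀ u, #{w | R u w} = #{w | u < w ∧ R u w} + #{w | w < u ∧ R w u} := by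
    intro u
    rw [← card_union_of_disjoint]
    · congr 1
      ext w
      simp only [mem_filter, mem_univ, true_and, mem_union]
      constructor
      · intro h
        rcases lt_trichotomy u w with e | e | e
        · exact Or.inl ⟨e, h⟩
        · exact absurd (e ▸ h) (hi w)
        · exact Or.inr ⟨e, hs _ _ h⟩
      · rintro (h | h)
        · exact h.2
        · exact hs _ _ h.2
    · rw [disjoint_filter]
      exact fun w _ h h' => lt_asymm h.1 h'.1
  have h3 : ∑ u : Fin n, #{w | w < u ∧ R w u} = ∑ u, #{w | u < w ∧ R u w} := by
    simp only [card_filter]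
    exact sum_comm
  rw [h1, sum_congr rfl fun u _ => h2 u, sum_add_distrib, h3, two_mul]

/-! ### The kernel -/

namespace Instance

variable (I : Instance)

/-- True twins: vertices with the same closed neighbourhood. -/
def Twin (u v : Fin I.n) : Prop := ∀ w, cadj I.graph u w ↔ cadj I.graph v w

/-- A vertex with more than `2 * k` twins; every solution leaves such a vertex untouched. -/
def Big (v : Fin I.n) : Prop := 2 * I.k < #{u | I.Twin u v}

/-- A vertex whose cluster is the same in all solutions, being the closed neighbourhood of
a big vertex. -/
def Forced (u : Fin I.n) : Prop := ∃ v, I.Big v ∧ cadj I.graph v u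

/-- The normalized graph, as a closed neighbourhood relation: all edits that concern
forced vertices have been carried out. -/
def Nadj (u w : Fin I.n) : Prop :=
  ((I.Forced u ∨ I.Forced w) ∧ ∃ v, I.Big v ∧ cadj I.graph v u ∧ cadj I.graph v w) ∨
    (¬ (I.Forced u ∨ I.Forced w) ∧ cadj I.graph u w)

/-- The number of edits made in the normalization. -/
noncomputable def defect : ℕ := ∑ u, #{w | u < w ∧ ¬ (cadj I.graph u w ↔ I.Nadj u w)}

/-- The number of vertices in the closed neighbourhood of `u` in the normalized graph. -/
noncomputable def sz (u : Fin I.n) : ℕ := #{w | I.Nadj u w}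

/-- The vertex `u` lies in an isolated clique of the normalized graph. -/
def Clean (u : Fin I.n) : Prop := ∀ w, I.Nadj u w → ∀ x, (I.Nadj w x ↔ I.Nadj u x)

/-- The vertex `u` lies in an isolated clique with more than `4 * k` vertices. -/
def Large (u : Fin I.n) : Prop := I.Clean u ∧ 4 * I.k < I.sz u

/-- The vertex `u` lies in a large isolated clique of maximum size. -/
def Top (u : Fin I.n) : Prop := I.Large u ∧ ∀ v, I.Large v → I.sz v ≤ I.sz u

/-- `z` is the first vertex in large isolated cliques of maximum size. -/
def Lead (z : Fin I.n) : Prop := I.Top z ∧ ∀ w, I.Top w → z ≤ w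

/-- Not all vertices lie in large isolated cliques. -/
def HasSmall : Prop := ∃ u, ¬ I.Large u

/-- The maximum size of a large isolated clique, or `0` if there is none. -/
noncomputable def maxSize : ℕ := ∑ z, if I.Lead z then I.sz z else 0

/-- `x` is one of the first `2 * k + 1` vertices that lie in isolated cliques of the same
size as its own, and this size is at most `4 * k`. -/
def Marked (x : Fin I.n) : Prop :=
  I.Clean x ∧ I.sz x ≤ 4 * I.k ∧ #{w | w < x ∧ I.Clean w ∧ I.sz w = I.sz x} ≤ 2 * I.k

/-- `u` is one of the first `4 * k + 1` vertices of the isolated clique that represents all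
large ones. If there are no other vertices then the representative is not needed. -/
def InTop (u : Fin I.n) : Prop :=
  I.HasSmall ∧ ∃ z, I.Lead z ∧ I.Nadj z u ∧ #{x | x < u ∧ I.Nadj z x} ≤ 4 * I.k

/-- The vertices of the kernel. -/
def Kept (u : Fin I.n) : Prop :=
  ¬ I.Clean u ∨ (∃ x, I.Marked x ∧ I.Nadj u x) ∨ I.InTop u

/-- The conditions under which an instance is found to have no solution: there are too many
forced edits, there are too many vertices outside isolated cliques, two large
isolated cliques have sizes that differ too much, or the largest isolated clique is too large for
the remaining vertices. -/
def Rejected : Prop :=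
  I.k < I.defect ∨ (∑ i : Fin I.n, if (i : ℕ) < I.k then 8 * I.k else 0) < #{u | ¬ I.Clean u} ∨
    (∃ u v, I.Large u ∧ I.Large v ∧ I.sz v + I.η < I.sz u) ∨
      (I.HasSmall ∧ ∃ z, I.Lead z ∧ I.η + (4 * I.k + 1) < I.sz z)

/-- The balance bound after the largest isolated clique has been cut to `4 * k + 1` vertices. -/
noncomputable def shrunkEta : ℕ := I.η - (I.maxSize - (4 * I.k + 1))

variable {I}

theorem Nadj.symm {u w : Fin I.n} (h : I.Nadj u w) : I.Nadj w u := by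
  rcases h with ⟨h, v, h1, h2, h3⟩ | ⟨h, h1⟩
  · exact Or.inl ⟨h.symm, v, h1, h3, h2⟩
  · exact Or.inr ⟨fun e => h e.symm, cadj_symm _ h1⟩

variable (I) in
theorem nadj_refl (u : Fin I.n) : I.Nadj u u := by
  by_cases h : I.Forced u
  · obtain ⟨v, h1, h2⟩ := h
    exact Or.inl ⟨Or.inl ⟨v, h1, h2⟩, v, h1, h2, h2⟩
  · exact Or.inr ⟨by tauto, cadj_refl _ _⟩

variable (I) in
theorem card_changed :
    #{p : Fin I.n × Fin I.n | ¬ (cadj I.graph p.1 p.2 ↔ I.Nadj p.1 p.2)} = 2 * I.defect := by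
  unfold defect
  convert card_pairs_eq_two_mul (R := fun u w => ¬ (cadj I.graph u w ↔ I.Nadj u w))
    (fun u v h e => h ⟨fun h' => ?_, fun h' => ?_⟩) fun u h => ?_
  · exact (e.1 (cadj_symm _ h')).symm
  · exact cadj_symm _ (e.2 h'.symm)
  · exact h (iff_of_true (cadj_refl _ _) (I.nadj_refl u))

/-! ### Normalization -/

section Normalization

variable {η : ℕ} {r : Fin I.n → Fin I.n → Prop}

theorem Big.iff_of_isSol (h : IsSol univ (cadj I.graph) (2 * I.k) η r) {v : Fin I.n}
    (hv : I.Big v) (w : Fin I.n) : cadj I.graph v w ↔ r v w :=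
  h.forced (Q := ({u | I.Twin u v} : Finset _)) (subset_univ _) hv (mem_univ v) (cadj_refl _ v)
    (fun _ hq w _ => (mem_filter.1 hq).2 w) w (mem_univ w)

theorem Forced.iff_of_isSol (h : IsSol univ (cadj I.graph) (2 * I.k) η r) {u : Fin I.n}
    (hu : I.Forced u) (w : Fin I.n) : I.Nadj u w ↔ r u w := by
  obtain ⟨v, hv, hvu⟩ := id hu
  have hrv := (hv.iff_of_isSol h u).1 hvu
  constructor
  · rintro (⟨-, v', hv', h1, h2⟩ | ⟨h1, -⟩)
    · exact h.equiv.trans (h.equiv.symm ((hv'.iff_of_isSol h u).1 h1))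
        ((hv'.iff_of_isSol h w).1 h2)
    · exact absurd (Or.inl hu) h1
  · intro hr
    exact Or.inl ⟨Or.inl hu, v, hv, hvu, (hv.iff_of_isSol h w).2 (h.equiv.trans hrv hr)⟩

/-- A pair that the normalization changes is changed by every solution. -/
theorem isSol_nadj (h : IsSol univ (cadj I.graph) (2 * I.k) η r) :
    I.defect ≤ I.k ∧ IsSol univ I.Nadj (2 * (I.k - I.defect)) η r := by
  have hsub : #{p : Fin I.n × Fin I.n | ¬ (cadj I.graph p.1 p.2 ↔ I.Nadj p.1 p.2)} +
      #{p ∈ (univ : Finset (Fin I.n)) ×ˢ univ | ¬ (I.Nadj p.1 p.2 ↔ r p.1 p.2)} ≤ 2 * I.k := by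
    refine le_trans ?_ h.cost
    have hch : ∀ u w, (cadj I.graph u w ↔ I.Nadj u w) ∨ (I.Nadj u w ↔ r u w) := by
      intro u w
      by_cases hu : I.Forced u
      · exact Or.inr (hu.iff_of_isSol h w)
      by_cases hw : I.Forced w
      · refine Or.inr ?_
        rw [show I.Nadj u w ↔ I.Nadj w u from ⟨Nadj.symm, Nadj.symm⟩, hw.iff_of_isSol h u]
        exact ⟨h.equiv.symm, h.equiv.symm⟩
      · left
        have hno : ¬ (I.Forced u ∨ I.Forced w) := not_or.2 ⟨hu, hw⟩
        simp only [Nadj, hno, false_and, not_false_eq_true, true_and, false_or]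
    rw [← card_union_of_disjoint]
    · refine card_le_card ?_
      rintro ⟨u, w⟩ hp
      have := hch u w
      simp only [mem_union, mem_filter, mem_univ, mem_product, true_and] at hp ⊢
      tauto
    · rw [disjoint_left]
      rintro ⟨u, w⟩ h1 h2
      have := hch u w
      simp only [mem_filter, mem_univ, mem_product, true_and] at h1 h2
      tauto
  rw [card_changed] at hsub
  exact ⟨by omega, h.equiv, by omega, h.bal⟩

theorem isSol_cadj (hd : I.defect ≤ I.k) (h : IsSol univ I.Nadj (2 * (I.k - I.defect)) η r) :
    IsSol univ (cadj I.graph) (2 * I.k) η r := by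
  refine ⟨h.equiv, ?_, h.bal⟩
  have h1 := h.cost
  have h2 := I.card_changed
  have h3 : #{p ∈ (univ : Finset (Fin I.n)) ×ˢ univ | ¬ (cadj I.graph p.1 p.2 ↔ r p.1 p.2)} ≤
      #{p : Fin I.n × Fin I.n | ¬ (cadj I.graph p.1 p.2 ↔ I.Nadj p.1 p.2)} +
      #{p ∈ (univ : Finset (Fin I.n)) ×ˢ univ | ¬ (I.Nadj p.1 p.2 ↔ r p.1 p.2)} := by
    refine le_trans (card_le_card ?_) (card_union_le _ _)
    rintro ⟨u, w⟩ hp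
    simp only [mem_union, mem_filter, mem_univ, mem_product, true_and] at hp ⊢
    tauto
  omega

theorem isYes_iff_nadj :
    I.IsYes ↔ I.defect ≤ I.k ∧ ∃ r, IsSol univ I.Nadj (2 * (I.k - I.defect)) I.η r := by
  unfold IsYes
  rw [exists_isSolution_iff]
  constructor
  · rintro ⟨r, h⟩
    exact ⟨(isSol_nadj h).1, r, (isSol_nadj h).2⟩
  · rintro ⟨hd, r, h⟩
    exact ⟨r, isSol_cadj hd h⟩

/-- A large class of a solution contains a big vertex of the original graph, so it is an
isolated clique of the normalized graph. -/
theorem nadj_iff_of_large_class (hd : I.defect ≤ I.k)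
    (h : IsSol univ I.Nadj (2 * (I.k - I.defect)) η r) {u : Fin I.n}
    (hu : 4 * I.k < #{w | r u w}) (w : Fin I.n) : I.Nadj u w ↔ r u w := by
  have h' := isSol_cadj hd h
  obtain ⟨v, -, huv, hv⟩ := h'.exists_twins (u := u) (by omega)
  have hbig : I.Big v := by
    refine lt_of_lt_of_le hv (card_le_card fun q hq => ?_)
    rw [mem_filter] at hq ⊢
    exact ⟨mem_univ q, fun w => hq.2 w (mem_univ w)⟩
  have hf : I.Forced u := ⟨v, hbig, (hbig.iff_of_isSol h' u).2 (h.equiv.symm huv)⟩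
  exact hf.iff_of_isSol h' w

theorem large_of_large_class (hd : I.defect ≤ I.k)
    (h : IsSol univ I.Nadj (2 * (I.k - I.defect)) η r) {u : Fin I.n}
    (hu : 4 * I.k < #{w | r u w}) : I.Large u := by
  have hn := nadj_iff_of_large_class hd h hu
  refine ⟨fun w hw x => ?_, ?_⟩
  · have hr : ∀ x, r w x ↔ r u x := fun x =>
      ⟨fun e => h.equiv.trans ((hn w).1 hw) e,
        fun e => h.equiv.trans (h.equiv.symm ((hn w).1 hw)) e⟩
    rw [nadj_iff_of_large_class hd h (by simpa only [hr] using hu), hr, hn]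
  · unfold sz
    simpa only [hn] using hu

theorem Large.iff_of_isSol (h : IsSol univ I.Nadj (2 * (I.k - I.defect)) η r) {u : Fin I.n}
    (hu : I.Large u) (w : Fin I.n) : I.Nadj u w ↔ r u w := by
  refine h.forced (Q := ({w | I.Nadj u w} : Finset _)) (subset_univ _) ?_ (mem_univ u)
    (I.nadj_refl u) (fun q hq w _ => hu.1 q (mem_filter.1 hq).2 w) w (mem_univ w)
  have := hu.2
  unfold sz at this
  omega

theorem card_class_le_of_not_large (hd : I.defect ≤ I.k)
    (h : IsSol univ I.Nadj (2 * (I.k - I.defect)) η r) {u : Fin I.n} (hu : ¬ I.Large u) :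
    #{w | r u w} ≤ 4 * I.k := by
  by_contra hcon
  exact hu (large_of_large_class hd h (not_le.1 hcon))

/-- Vertices outside isolated cliques lie in classes with a touched vertex, and those
are at most `2 * k` classes with at most `4 * k` vertices each. -/
theorem card_not_clean_le (hd : I.defect ≤ I.k)
    (h : IsSol univ I.Nadj (2 * (I.k - I.defect)) η r) :
    #{u | ¬ I.Clean u} ≤ 2 * I.k * (4 * I.k) := by
  set T : Finset (Fin I.n) :=
    {t | Touched univ I.Nadj r t ∧ #{w | r t w} ≤ 4 * I.k}
  have hT : #T ≤ 2 * I.k := by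
    refine le_trans (card_le_card fun t ht => ?_) (h.card_touched_le.trans (by omega))
    exact mem_filter.2 ⟨mem_univ t, (mem_filter.1 ht).2.1⟩
  refine le_trans (card_le_card (t := T.biUnion fun t => {w | r t w}) fun u hu => ?_)
    (le_trans (card_biUnion_le_card_mul _ _ (4 * I.k) fun t ht => (mem_filter.1 ht).2.2)
      (Nat.mul_le_mul_right _ hT))
  have hu' : ¬ I.Clean u := (mem_filter.1 hu).2
  have hex : ∃ t, r u t ∧ ∃ w, ¬ (I.Nadj t w ↔ r t w) := by
    by_contra! hcon
    refine hu' fun w hw x => ?_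
    have h1 := hcon u (h.equiv.refl u)
    have h2 := (h1 w).1 hw
    rw [hcon w h2 x, h1 x]
    exact ⟨fun e => h.equiv.trans h2 e, fun e => h.equiv.trans (h.equiv.symm h2) e⟩
  obtain ⟨t, hut, w, hw⟩ := hex
  refine mem_biUnion.2 ⟨t, mem_filter.2 ⟨mem_univ t, ⟨w, mem_univ w, hw⟩, ?_⟩,
    mem_filter.2 ⟨mem_univ u, h.equiv.symm hut⟩⟩
  by_contra hcon
  exact hw (nadj_iff_of_large_class hd h (not_le.1 hcon) w)

theorem not_isYes_of_rejected (hI : I.Rejected) : ¬ I.IsYes := by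
  rw [isYes_iff_nadj]
  rintro ⟨hd, r, h⟩
  rcases hI with hI | hI | ⟨u, v, hu, hv, hlt⟩ | ⟨⟨v, hv⟩, z, hz, hlt⟩
  · omega
  · have h1 := card_not_clean_le hd h
    rcases le_total I.k I.n with hkn | hkn
    · have : (∑ i : Fin I.n, if (i : ℕ) < I.k then 8 * I.k else 0) = I.k * (8 * I.k) := by
        rw [Fin.sum_univ_eq_sum_range (fun i => if i < I.k then 8 * I.k else 0), ← sum_filter,
          sum_const, smul_eq_mul]
        congr 1
        trans #(range I.k)
        · congr 1
          ext i
          simp only [mem_filter, mem_range]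
          omega
        · exact card_range _
      rw [this] at hI
      nlinarith
    · have h2 : (∑ i : Fin I.n, if (i : ℕ) < I.k then 8 * I.k else 0) = I.n * (8 * I.k) := by
        rw [sum_congr rfl fun i _ => if_pos (i.2.trans_le hkn), sum_const, card_univ,
          Fintype.card_fin, smul_eq_mul]
      have h3 : #{u | ¬ I.Clean u} ≤ I.n := by
        simpa using card_le_univ ({u | ¬ I.Clean u} : Finset (Fin I.n))
      rw [h2] at hI
      rcases Nat.eq_zero_or_pos I.n with hn | hn
      · omega
      · nlinarith
  · have := h.bal u (mem_univ u) v (mem_univ v)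
    simp only [← hu.iff_of_isSol h, ← hv.iff_of_isSol h] at this
    change I.sz u ≤ I.sz v + I.η at this
    omega
  · have := h.bal z (mem_univ z) v (mem_univ v)
    simp only [← hz.1.1.iff_of_isSol h] at this
    change I.sz z ≤ _ at this
    have := card_class_le_of_not_large hd h hv
    omega

end Normalization

end Instance

end BalancedCluster

namespace BalancedCluster

open Finset Classical

namespace Instance

variable {I : Instance}

/-! ### Replacing the large isolated cliques by one -/

section Shrink

theorem Clean.congr {u w : Fin I.n} (hu : I.Clean u) (h : I.Nadj u w) : I.Clean w := by
  intro x hx y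
  rw [hu w h] at hx ⊢
  exact hu x hx y

theorem Clean.sz_eq {u w : Fin I.n} (hu : I.Clean u) (h : I.Nadj u w) : I.sz w = I.sz u := by
  unfold sz
  simp only [hu w h]

theorem Large.congr {u w : Fin I.n} (hu : I.Large u) (h : I.Nadj u w) : I.Large w :=
  ⟨hu.1.congr h, by rw [hu.1.sz_eq h]; exact hu.2⟩

theorem Lead.eq {z z' : Fin I.n} (h : I.Lead z) (h' : I.Lead z') : z = z' :=
  le_antisymm (h.2 _ h'.1) (h'.2 _ h.1)

theorem Lead.maxSize_eq {z : Fin I.n} (h : I.Lead z) : I.maxSize = I.sz z := by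
  unfold maxSize
  rw [sum_eq_single z (fun z' _ hne => if_neg fun h' => hne (h'.eq h)) (by simp), if_pos h]

theorem exists_lead {u : Fin I.n} (hu : I.Large u) : ∃ z, I.Lead z := by
  obtain ⟨t, ht, hmax⟩ := exists_max_image ({u | I.Large u} : Finset _) I.sz
    ⟨u, mem_filter.2 ⟨mem_univ u, hu⟩⟩
  have htop : I.Top t :=
    ⟨(mem_filter.1 ht).2, fun v hv => hmax v (mem_filter.2 ⟨mem_univ v, hv⟩)⟩
  obtain ⟨z, hz, hmin⟩ := exists_min_image ({u | I.Top u} : Finset _) id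
    ⟨t, mem_filter.2 ⟨mem_univ t, htop⟩⟩
  exact ⟨z, (mem_filter.1 hz).2, fun w hw => hmin w (mem_filter.2 ⟨mem_univ w, hw⟩)⟩

theorem maxSize_eq_zero (h : ∀ u, ¬ I.Large u) : I.maxSize = 0 :=
  sum_eq_zero fun z _ => if_neg fun hz => h z hz.1.1

theorem InTop.large {u : Fin I.n} (h : I.InTop u) : I.Large u := by
  obtain ⟨-, z, hz, hzu, -⟩ := h
  exact hz.1.1.congr hzu

theorem card_inTop (h : I.HasSmall) {z : Fin I.n} (hz : I.Lead z) :
    #{u | I.InTop u} = 4 * I.k + 1 := by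
  have h1 := card_rank_lt ({u | I.Nadj z u} : Finset (Fin I.n)) (4 * I.k + 1)
  have h2 := hz.1.1.2
  unfold sz at h2
  rw [min_eq_right (by omega)] at h1
  rw [← h1]
  congr 1
  ext u
  simp only [mem_filter, mem_univ, true_and, filter_filter, Nat.lt_succ_iff]
  constructor
  · rintro ⟨-, z', hz', hu, hc⟩
    obtain rfl := hz'.eq hz
    refine ⟨hu, ?_⟩
    simpa only [and_comm] using hc
  · rintro ⟨hu, hc⟩
    refine ⟨h, z, hz, hu, ?_⟩
    simpa only [and_comm] using hc

/-- All vertices outside large isolated cliques, and the representative of the latter. -/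
def Shrunk (u : Fin I.n) : Prop := ¬ I.Large u ∨ I.InTop u

/-- A solution stays one when the representative replaces the large cliques: every other class has
between `M - η` and `4 * k` vertices, where `M` is the maximum size of a large clique. -/
theorem exists_isSol_shrunk_of_lead (hd : I.defect ≤ I.k) (hI : ¬ I.Rejected)
    (hs : I.HasSmall) {z : Fin I.n} (hz : I.Lead z)
    (h : ∃ r, IsSol univ I.Nadj (2 * (I.k - I.defect)) I.η r) :
    ∃ r, IsSol ({u | I.Shrunk u} : Finset _) I.Nadj (2 * (I.k - I.defect)) I.shrunkEta r := by
  obtain ⟨r, h⟩ := h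
  have hM : I.sz z ≤ I.η + (4 * I.k + 1) := by
    by_contra hcon
    exact hI (Or.inr (Or.inr (Or.inr ⟨hs, z, hz, not_le.1 hcon⟩)))
  have hzL := hz.1.1.2
  have hη : I.shrunkEta = I.η - (I.sz z - (4 * I.k + 1)) := by
    unfold shrunkEta; rw [hz.maxSize_eq]
  have hlow : ∀ u, ¬ I.Large u → ({w ∈ ({u | I.Shrunk u} : Finset _) | r u w} : Finset _) =
      ({w | r u w} : Finset _) := by
    intro u hu
    ext w
    simp only [mem_filter, mem_univ, true_and, and_iff_right_iff_imp]
    intro hw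
    refine Or.inl fun hL => hu (hL.congr ?_)
    exact (hL.iff_of_isSol h u).2 (h.equiv.symm hw)
  have htop : ∀ u, I.InTop u → ({w ∈ ({u | I.Shrunk u} : Finset _) | r u w} : Finset _) =
      ({w | I.InTop w} : Finset _) := by
    intro u hu
    ext w
    simp only [mem_filter, mem_univ, true_and]
    constructor
    · rintro ⟨hw | hw, hr⟩
      · exact absurd (hu.large.congr ((hu.large.iff_of_isSol h w).2 hr)) hw
      · exact hw
    · intro hw
      refine ⟨Or.inr hw, ?_⟩
      obtain ⟨-, z', hz', h1, -⟩ := hu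
      obtain ⟨-, z'', hz'', h2, -⟩ := hw
      obtain rfl := hz'.eq hz
      obtain rfl := hz'.eq hz''
      rw [hz.1.1.iff_of_isSol h] at h1 h2
      exact h.equiv.trans (h.equiv.symm h1) h2
  have hcard := card_inTop hs hz
  have hzb : ∀ u, I.sz z ≤ #{w | r u w} + I.η := by
    intro u
    have := h.bal z (mem_univ z) u (mem_univ u)
    simp only [← hz.1.1.iff_of_isSol h] at this
    exact this
  refine ⟨r, h.equiv, ?_, fun u hu v hv => ?_⟩
  · refine le_trans (card_le_card ?_) h.cost
    exact filter_subset_filter _ (product_subset_product (subset_univ _) (subset_univ _))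
  · have hle : #{w ∈ ({u | I.Shrunk u} : Finset _) | r u w} ≤ 4 * I.k + 1 := by
      rcases (mem_filter.1 hu).2 with hu' | hu'
      · rw [hlow u hu']
        exact (card_class_le_of_not_large hd h hu').trans (Nat.le_succ _)
      · rw [htop u hu', hcard]
    rcases (mem_filter.1 hv).2 with hv' | hv'
    · rw [hlow v hv']
      have := hzb v
      omega
    · rw [htop v hv', hcard]
      omega

/-- Conversely, a solution with the representative leaves it untouched, so its other
classes have sizes within `shrunkEta` of `4 * k + 1`; the large cliques are put back as classes. -/
theorem exists_isSol_of_shrunk_of_lead (hI : ¬ I.Rejected)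
    (hs : I.HasSmall) {z : Fin I.n} (hz : I.Lead z)
    (h : ∃ r, IsSol ({u | I.Shrunk u} : Finset _) I.Nadj (2 * (I.k - I.defect)) I.shrunkEta r) :
    ∃ r, IsSol univ I.Nadj (2 * (I.k - I.defect)) I.η r := by
  obtain ⟨r, h⟩ := h
  have hM : I.sz z ≤ I.η + (4 * I.k + 1) := by
    by_contra hcon
    exact hI (Or.inr (Or.inr (Or.inr ⟨hs, z, hz, not_le.1 hcon⟩)))
  have hLL : ∀ u v, I.Large u → I.Large v → I.sz u ≤ I.sz v + I.η := by
    intro u v hu hv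
    by_contra hcon
    exact hI (Or.inr (Or.inr (Or.inl ⟨u, v, hu, hv, not_le.1 hcon⟩)))
  have hη : I.shrunkEta = I.η - (I.sz z - (4 * I.k + 1)) := by
    unfold shrunkEta; rw [hz.maxSize_eq]
  have hcard := card_inTop hs hz
  have hnadj : ∀ u w, I.InTop u → I.Shrunk w → (I.Nadj u w ↔ I.InTop w) := by
    intro u w hu hw
    constructor
    · intro huw
      rcases hw with hw | hw
      · exact absurd (hu.large.congr huw) hw
      · exact hw
    · intro hw
      obtain ⟨-, z', hz', h1, -⟩ := hu
      obtain ⟨-, z'', hz'', h2, -⟩ := hw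
      obtain rfl := hz'.eq hz''
      exact (hz'.1.1.1 u h1 w).2 h2
  have hforced : ∀ u, I.InTop u → ∀ w, I.Shrunk w → (I.Nadj u w ↔ r u w) := by
    intro u hu w hw
    refine h.forced (Q := ({w | I.InTop w} : Finset _))
      (fun q hq => mem_filter.2 ⟨mem_univ q, Or.inr (mem_filter.1 hq).2⟩) (by omega)
      (mem_filter.2 ⟨mem_univ u, Or.inr hu⟩) (I.nadj_refl u) (fun q hq w hw => ?_) w
      (mem_filter.2 ⟨mem_univ w, hw⟩)
    have hq' := (mem_filter.1 hq).2
    exact hu.large.1 q ((hnadj u q hu (Or.inr hq')).2 hq') w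
  have htop : ∀ u, I.InTop u → #{w ∈ ({u | I.Shrunk u} : Finset _) | r u w} = 4 * I.k + 1 := by
    intro u hu
    rw [← hcard]
    congr 1
    ext w
    simp only [mem_filter, mem_univ, true_and]
    constructor
    · rintro ⟨hw, hr⟩
      exact (hnadj u w hu hw).1 ((hforced u hu w hw).2 hr)
    · intro hw
      exact ⟨Or.inr hw, (hforced u hu w (Or.inr hw)).1 ((hnadj u w hu (Or.inr hw)).2 hw)⟩
  obtain ⟨t, ht⟩ : ∃ t, I.InTop t := by
    obtain ⟨t, ht⟩ := card_pos.1 (by omega : 0 < #{u | I.InTop u})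
    exact ⟨t, (mem_filter.1 ht).2⟩
  have htS : t ∈ ({u | I.Shrunk u} : Finset _) := mem_filter.2 ⟨mem_univ t, Or.inr ht⟩
  have hhigh : ∀ u, I.Large u → #{w | glue I.Large I.Nadj r u w} = I.sz u := by
    intro u hu
    unfold sz
    congr 1
    ext w
    simp only [mem_filter, mem_univ, true_and, glue_of_pos hu, and_iff_right_iff_imp]
    exact hu.congr
  have hlow : ∀ u, ¬ I.Large u → #{w | glue I.Large I.Nadj r u w} =
      #{w ∈ ({u | I.Shrunk u} : Finset _) | r u w} := by
    intro u hu
    congr 1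
    ext w
    simp only [mem_filter, mem_univ, true_and, glue_of_neg hu]
    refine and_congr_left fun hr => ⟨Or.inl, ?_⟩
    rintro (hw | hw)
    · exact hw
    · have h1 := (hforced w hw u (Or.inl hu)).2 (h.equiv.symm hr)
      exact absurd (hw.large.congr h1) hu
  refine ⟨glue I.Large I.Nadj r, glue_equivalence h.equiv (fun u _ => I.nadj_refl u)
    (fun u v _ _ e => e.symm) (fun u v w hu _ _ e e' => (hu.1 v e w).1 e'), ?_,
    fun u _ v _ => ?_⟩
  · refine le_trans (glue_cost (fun _ _ e => e.symm) (fun u _ w _ hu e => hu.congr e)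
      (fun _ _ _ _ _ _ => Iff.rfl)) (le_trans (card_le_card ?_) h.cost)
    refine filter_subset_filter _ (product_subset_product ?_ ?_) <;>
    · intro u hu
      exact mem_filter.2 ⟨mem_univ u, Or.inl (mem_filter.1 hu).2⟩
  · have hzL := hz.1.1.2
    by_cases hu : I.Large u <;> by_cases hv : I.Large v
    · rw [hhigh u hu, hhigh v hv]
      exact hLL u v hu hv
    · rw [hhigh u hu, hlow v hv]
      have h1 := hz.1.2 u hu
      have h2 := h.bal t htS v (mem_filter.2 ⟨mem_univ v, Or.inl hv⟩)
      rw [htop t ht] at h2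
      omega
    · rw [hlow u hu, hhigh v hv]
      have h1 := hv.2
      have h2 := h.bal u (mem_filter.2 ⟨mem_univ u, Or.inl hu⟩) t htS
      rw [htop t ht] at h2
      omega
    · rw [hlow u hu, hlow v hv]
      have h2 := h.bal u (mem_filter.2 ⟨mem_univ u, Or.inl hu⟩) v
        (mem_filter.2 ⟨mem_univ v, Or.inl hv⟩)
      omega

theorem exists_isSol_shrunk_iff (hd : I.defect ≤ I.k) (hI : ¬ I.Rejected) :
    (∃ r, IsSol univ I.Nadj (2 * (I.k - I.defect)) I.η r) ↔
      ∃ r, IsSol ({u | I.Shrunk u} : Finset _) I.Nadj (2 * (I.k - I.defect)) I.shrunkEta r := by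
  by_cases hL : ∃ u, I.Large u
  · obtain ⟨u, hu⟩ := hL
    obtain ⟨z, hz⟩ := exists_lead hu
    by_cases hs : I.HasSmall
    · exact ⟨exists_isSol_shrunk_of_lead hd hI hs hz, exists_isSol_of_shrunk_of_lead hI hs hz⟩
    · -- All components are cliques of admissible sizes, so no edit is needed.
      have hall : ∀ u, I.Large u := by
        unfold HasSmall at hs
        push Not at hs
        exact hs
      have hemp : ∀ u, ¬ I.Shrunk u := fun u h => h.elim (fun h => h (hall u)) fun h => hs h.1
      refine iff_of_true ⟨I.Nadj, ?_, ?_, ?_⟩ ⟨Eq, eq_equivalence, ?_, ?_⟩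
      · exact ⟨I.nadj_refl, fun e => e.symm, fun {u v w} e e' => ((hall u).1 v e w).1 e'⟩
      · simp
      · intro u _ v _
        by_contra hcon
        exact hI (Or.inr (Or.inr (Or.inl ⟨u, v, hall u, hall v, not_le.1 hcon⟩)))
      · simp [hemp]
      · simp [hemp]
  · push Not at hL
    have h1 : ({u | I.Shrunk u} : Finset (Fin I.n)) = univ := by
      ext u
      exact iff_of_true (mem_filter.2 ⟨mem_univ u, Or.inl (hL u)⟩) (mem_univ u)
    rw [h1]
    unfold shrunkEta
    rw [maxSize_eq_zero hL, Nat.zero_sub, Nat.sub_zero]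

end Shrink

/-! ### Correctness and size of the kernel -/

section Kernel

theorem Marked.kept {x u : Fin I.n} (hx : I.Marked x) (h : I.Nadj x u) : I.Kept u :=
  Or.inr (Or.inl ⟨x, hx, h.symm⟩)

/-- The deleted cliques are those without a marked vertex. If such a clique has size `s`, then
there are `2 * k + 1` marked vertices in cliques of size `s`, and these cliques are kept. -/
theorem exists_isSol_kept_iff :
    (∃ r, IsSol ({u | I.Shrunk u} : Finset _) I.Nadj (2 * (I.k - I.defect)) I.shrunkEta r) ↔
      ∃ r, IsSol ({u | I.Kept u} : Finset _) I.Nadj (2 * (I.k - I.defect)) I.shrunkEta r := by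
  have hSW : ∀ u, I.Kept u → I.Shrunk u := by
    rintro u (hu | ⟨x, hx, hux⟩ | hu)
    · exact Or.inl fun h => hu h.1
    · refine Or.inl fun h => ?_
      have h1 := h.1.sz_eq hux
      have h2 := h.2
      have h3 := hx.2.1
      omega
    · exact Or.inr hu
  have hout : ∀ u, I.Shrunk u → ¬ I.Kept u →
      I.Clean u ∧ I.sz u ≤ 4 * I.k ∧ ∀ x, I.Nadj u x → ¬ I.Marked x := by
    intro u hu hk
    unfold Kept at hk
    push Not at hk
    refine ⟨hk.1, ?_, fun x hx hm => hk.2.1 x hm hx⟩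
    rcases hu with hu | hu
    · by_contra hcon
      exact hu ⟨hk.1, not_le.1 hcon⟩
    · exact absurd hu hk.2.2
  -- Small isolated cliques lie inside the vertex set left after the large ones are replaced.
  have hsh : ∀ u, I.Clean u → I.sz u ≤ 4 * I.k → ∀ w, I.Nadj u w → I.Shrunk w := by
    intro u hu hsz w huw
    refine Or.inl fun h => ?_
    have h1 := hu.sz_eq huw
    have h2 := h.2
    omega
  have hszS : ∀ u, I.Clean u → I.sz u ≤ 4 * I.k →
      #{w ∈ ({u | I.Shrunk u} : Finset _) | I.Nadj u w} = I.sz u := by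
    intro u hu hsz
    unfold sz
    congr 1
    ext w
    simp only [mem_filter, mem_univ, true_and, and_iff_right_iff_imp]
    exact hsh u hu hsz w
  refine exists_isSol_subset_iff I.nadj_refl (fun _ _ e => e.symm) _
    (fun u hu => mem_filter.2 ⟨mem_univ u, hSW u (mem_filter.1 hu).2⟩)
    (fun u hu hk x hx hux => ?_) (fun u hu hk => ?_)
  · simp only [mem_filter, mem_univ, true_and] at hu hk hx ⊢
    obtain ⟨h1, h2, h3⟩ := hout u hu hk
    refine ⟨?_, fun w _ => h1 x hux w⟩
    rintro (hx' | ⟨y, hy, hxy⟩ | hx')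
    · exact hx' (h1.congr hux)
    · exact h3 y ((h1 x hux y).1 hxy) hy
    · have h4 := hx'.large.2
      have h5 := h1.sz_eq hux
      omega
  · simp only [mem_filter, mem_univ, true_and] at hu hk
    obtain ⟨h1, h2, h3⟩ := hout u hu hk
    set P : Finset (Fin I.n) := {w | I.Clean w ∧ I.sz w = I.sz u} with hP
    have hrank : ∀ x ∈ P, (#{y ∈ P | y < x} < 2 * I.k + 1 ↔ I.Marked x) := by
      intro x hx
      obtain ⟨hx1, hx2⟩ := (mem_filter.1 hx).2
      have e : ({y ∈ P | y < x} : Finset _) =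
          ({w | w < x ∧ I.Clean w ∧ I.sz w = I.sz x} : Finset _) := by
        ext y
        simp only [hP, mem_filter, mem_univ, true_and, hx2]
        exact and_comm
      unfold Marked
      rw [e, Nat.lt_succ_iff]
      exact ⟨fun h => ⟨hx1, hx2 ▸ h2, h⟩, fun h => h.2.2⟩
    have huP : u ∈ P := mem_filter.2 ⟨mem_univ u, h1, rfl⟩
    have hPcard : 2 * I.k + 1 ≤ #P := by
      by_contra hcon
      refine h3 u (I.nadj_refl u) ((hrank u huP).1 (lt_of_le_of_lt ?_ (not_le.1 hcon)))
      exact card_le_card (filter_subset _ _)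
    refine ⟨{x ∈ P | #{y ∈ P | y < x} < 2 * I.k + 1}, fun p hp => ?_, ?_, fun p hp => ?_⟩
    · rw [mem_filter] at hp
      exact mem_filter.2 ⟨mem_univ p, ((hrank p hp.1).1 hp.2).kept (I.nadj_refl p)⟩
    · rw [card_rank_lt, min_eq_right hPcard]
      omega
    · rw [mem_filter] at hp
      have hm := (hrank p hp.1).1 hp.2
      have hp2 := (mem_filter.1 hp.1).2.2
      refine ⟨fun x _ hpx => ⟨mem_filter.2 ⟨mem_univ x, hm.kept hpx⟩,
        fun w _ => hm.1 x hpx w⟩, ?_⟩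
      rw [hszS p hm.1 hm.2.1, hszS u h1 h2, hp2]

/-- The number of vertices of the kernel. -/
noncomputable def keptCard (I : Instance) : ℕ := #{u | I.Kept u}

theorem card_marked_le (s : ℕ) : #{x | I.Marked x ∧ I.sz x = s} ≤ 2 * I.k + 1 := by
  have h := card_rank_lt ({w | I.Clean w ∧ I.sz w = s} : Finset (Fin I.n)) (2 * I.k + 1)
  refine le_trans (card_le_card fun x hx => ?_) (h.le.trans (min_le_right _ _))
  obtain ⟨⟨h1, h2, h3⟩, h4⟩ := (mem_filter.1 hx).2
  refine mem_filter.2 ⟨mem_filter.2 ⟨mem_univ x, h1, h4⟩, Nat.lt_succ_of_le (le_trans ?_ h3)⟩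
  refine card_le_card fun y hy => ?_
  simp only [mem_filter, mem_univ, true_and] at hy ⊢
  exact ⟨hy.2, hy.1.1, hy.1.2.trans h4.symm⟩

theorem keptCard_le (hI : ¬ I.Rejected) : I.keptCard ≤ 100 * (I.k + 1) ^ 3 := by
  have h1 : #{u | ¬ I.Clean u} ≤ I.k * (8 * I.k) := by
    have h : #{u | ¬ I.Clean u} ≤ ∑ i : Fin I.n, if (i : ℕ) < I.k then 8 * I.k else 0 := by
      by_contra hcon
      exact hI (Or.inr (Or.inl (not_le.1 hcon)))
    refine h.trans ?_
    rw [Fin.sum_univ_eq_sum_range (fun i => if i < I.k then 8 * I.k else 0), ← sum_filter,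
      sum_const, smul_eq_mul]
    refine Nat.mul_le_mul_right _ ?_
    refine le_trans (card_le_card (t := range I.k) fun i hi => ?_) (card_range _).le
    exact mem_range.2 (mem_filter.1 hi).2
  have h2 : #{u | ∃ x, I.Marked x ∧ I.Nadj u x} ≤
      (4 * I.k + 1) * ((2 * I.k + 1) * (4 * I.k)) := by
    have hsub : ({u | ∃ x, I.Marked x ∧ I.Nadj u x} : Finset (Fin I.n)) ⊆
        (range (4 * I.k + 1)).biUnion fun s =>
          ({x | I.Marked x ∧ I.sz x = s} : Finset (Fin I.n)).biUnion fun x => {w | I.Nadj x w} := by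
      intro u hu
      obtain ⟨x, hx, hux⟩ := (mem_filter.1 hu).2
      refine mem_biUnion.2 ⟨I.sz x, mem_range.2 (Nat.lt_succ_of_le hx.2.1), mem_biUnion.2
        ⟨x, mem_filter.2 ⟨mem_univ x, hx, rfl⟩, mem_filter.2 ⟨mem_univ u, hux.symm⟩⟩⟩
    refine (card_le_card hsub).trans ((card_biUnion_le_card_mul _ _ _ fun s _ => ?_).trans
      (Nat.mul_le_mul_right _ (card_range _).le))
    refine (card_biUnion_le_card_mul _ _ _ fun x hx => ?_).trans
      (Nat.mul_le_mul_right _ (card_marked_le s))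
    exact (mem_filter.1 hx).2.1.2.1
  have h3 : #{u | I.InTop u} ≤ 4 * I.k + 1 := by
    by_cases h : ∃ u, I.InTop u
    · obtain ⟨u, hs, z, hz, -⟩ := h
      exact (card_inTop hs hz).le
    · push Not at h
      simp [h]
  have h4 : I.keptCard ≤ #{u | ¬ I.Clean u} + (#{u | ∃ x, I.Marked x ∧ I.Nadj u x} +
      #{u | I.InTop u}) := by
    refine le_trans (card_le_card fun u hu => ?_)
      ((card_union_le _ _).trans (Nat.add_le_add_left (card_union_le _ _) _))
    rw [mem_union, mem_union]
    exact (mem_filter.1 hu).2.imp (fun h => mem_filter.2 ⟨mem_univ u, h⟩)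
      (Or.imp (fun h => mem_filter.2 ⟨mem_univ u, h⟩) fun h => mem_filter.2 ⟨mem_univ u, h⟩)
  calc I.keptCard ≤ I.k * (8 * I.k) + ((4 * I.k + 1) * ((2 * I.k + 1) * (4 * I.k)) +
        (4 * I.k + 1)) := by omega
    _ ≤ 100 * (I.k + 1) ^ 3 := by nlinarith

/-- The position of `u` among the vertices of the kernel. -/
noncomputable def pos (I : Instance) (u : Fin I.n) : ℕ := #{w | I.Kept w ∧ w < u}

/-- Adjacency in the output; the output for a rejected instance is a path with three
vertices. -/
def OutAdj (I : Instance) (i j : ℕ) : Prop :=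
  i ≠ j ∧ ((I.Rejected ∧ (i = 1 ∨ j = 1)) ∨
    (¬ I.Rejected ∧ ∃ u v, I.Kept u ∧ I.Kept v ∧ I.pos u = i ∧ I.pos v = j ∧ I.Nadj u v))

/-- The output of the kernelization. -/
noncomputable def kernel (I : Instance) : Instance where
  n := if I.Rejected then 3 else I.keptCard
  graph :=
    { Adj := fun i j => I.OutAdj i j
      symm := ⟨fun _ _ h => ⟨h.1.symm, h.2.imp (fun h => ⟨h.1, h.2.symm⟩)
        fun ⟨h, u, v, h1, h2, h3, h4, h5⟩ => ⟨h, v, u, h2, h1, h4, h3, h5.symm⟩⟩⟩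
      loopless := ⟨fun _ h => h.1 rfl⟩ }
  k := if I.Rejected then 0 else I.k - I.defect
  η := if I.Rejected then 0 else min I.keptCard I.shrunkEta

theorem exists_bijOn_kept : ∃ φ : Fin I.keptCard → Fin I.n,
    Set.BijOn φ (univ : Finset (Fin I.keptCard)) ({u | I.Kept u} : Finset (Fin I.n)) ∧
      ∀ i, I.Kept (φ i) ∧ I.pos (φ i) = i := by
  have him := rank_image ({u | I.Kept u} : Finset (Fin I.n))
  have hpos : ∀ u, #{y ∈ ({u | I.Kept u} : Finset (Fin I.n)) | y < u} = I.pos u := by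
    intro u
    unfold pos
    rw [filter_filter]
  have hinj := rank_injOn ({u | I.Kept u} : Finset (Fin I.n))
  simp only [hpos] at him hinj
  have hex : ∀ i : Fin I.keptCard, ∃ u, I.Kept u ∧ I.pos u = i := by
    intro i
    have hi : (i : ℕ) ∈ range #({u | I.Kept u} : Finset (Fin I.n)) := mem_range.2 i.2
    rw [← him] at hi
    obtain ⟨u, hu, e⟩ := mem_image.1 hi
    exact ⟨u, (mem_filter.1 hu).2, e⟩
  choose φ hφ using hex
  refine ⟨φ, ⟨fun i _ => ?_, fun i _ j _ e => ?_, fun u hu => ?_⟩, hφ⟩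
  · simpa using (hφ i).1
  · have := (hφ i).2
    rw [e, (hφ j).2] at this
    exact Fin.ext this.symm
  · have hu' : I.pos u ∈ range #({u | I.Kept u} : Finset (Fin I.n)) := by
      rw [← him]
      exact mem_image_of_mem _ hu
    refine ⟨⟨I.pos u, mem_range.1 hu'⟩, by simp, hinj ?_ hu (hφ _).2⟩
    simpa using (hφ _).1

/-- A path with three vertices needs an edit. -/
theorem not_isYes_path {J : Instance} (hn : J.n = 3) (hk : J.k = 0)
    (hG : ∀ i j : Fin J.n, J.graph.Adj i j ↔ i ≠ j ∧ ((i : ℕ) = 1 ∨ (j : ℕ) = 1)) :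
    ¬ J.IsYes := by
  unfold IsYes
  rw [exists_isSolution_iff]
  rintro ⟨r, h⟩
  have hc := h.cost
  rw [hk, mul_zero, Nat.le_zero, card_eq_zero, filter_eq_empty_iff] at hc
  have hr : ∀ i j, cadj J.graph i j ↔ r i j := fun i j =>
    not_not.1 (hc (x := (i, j)) (by simp))
  have h01 : r ⟨0, by omega⟩ ⟨1, by omega⟩ := (hr _ _).1 (Or.inr ((hG _ _).2 (by simp)))
  have h12 : r ⟨1, by omega⟩ ⟨2, by omega⟩ := (hr _ _).1 (Or.inr ((hG _ _).2 (by simp)))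
  have h02 := (hr _ _).2 (h.equiv.trans h01 h12)
  unfold cadj at h02
  rw [hG] at h02
  simp at h02

theorem kernel_isYes_iff (I : Instance) : I.kernel.IsYes ↔ I.IsYes := by
  by_cases hI : I.Rejected
  · refine iff_of_false (not_isYes_path (by simp [kernel, hI]) (by simp [kernel, hI]) ?_)
      (not_isYes_of_rejected hI)
    intro i j
    change I.OutAdj i j ↔ _
    simp [OutAdj, hI, Fin.ext_iff]
  · have hd : I.defect ≤ I.k := by
      by_contra hcon
      exact hI (Or.inl (not_le.1 hcon))
    rw [isYes_iff_nadj (I := I), and_iff_right hd, exists_isSol_shrunk_iff hd hI, exists_isSol_kept_iff]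
    obtain ⟨J, hJ⟩ : ∃ J, J = I.kernel := ⟨_, rfl⟩
    have hn : J.n = I.keptCard := by simp [hJ, kernel, hI]
    have hk : J.k = I.k - I.defect := by simp [hJ, kernel, hI]
    have hη : J.η = min I.keptCard I.shrunkEta := by simp [hJ, kernel, hI]
    have hG : ∀ i j : Fin J.n, J.graph.Adj i j ↔ I.OutAdj i j := by
      subst hJ
      exact fun i j => Iff.rfl
    rw [← hJ]
    clear hJ
    obtain ⟨n, G, k, η⟩ := J
    subst hn hk hη
    obtain ⟨φ, hφ, hφ'⟩ := I.exists_bijOn_kept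
    have hadj : ∀ i j, cadj G i j ↔ I.Nadj (φ i) (φ j) := by
      intro i j
      unfold cadj
      rw [hG]
      constructor
      · rintro (rfl | ⟨-, ⟨h, -⟩ | ⟨-, u, v, h1, h2, h3, h4, h5⟩⟩)
        · exact I.nadj_refl _
        · exact absurd h hI
        · obtain ⟨i', -, rfl⟩ := hφ.surjOn (by simpa using h1)
          obtain ⟨j', -, rfl⟩ := hφ.surjOn (by simpa using h2)
          rw [(hφ' _).2] at h3 h4
          rwa [← Fin.ext h3, ← Fin.ext h4]
      · intro h
        by_cases e : i = j
        · exact Or.inl e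
        · exact Or.inr ⟨fun e' => e (Fin.ext e'), Or.inr ⟨hI, φ i, φ j, (hφ' i).1, (hφ' j).1,
            (hφ' i).2, (hφ' j).2, h⟩⟩
    unfold IsYes
    rw [exists_isSolution_iff]
    constructor
    · rintro ⟨r, h⟩
      have h' : IsSol univ (cadj G) (2 * (I.k - I.defect)) I.shrunkEta r :=
        h.mono le_rfl (min_le_right _ _)
      rcases Nat.eq_zero_or_pos I.keptCard with h0 | h0
      · have hemp : ({u | I.Kept u} : Finset (Fin I.n)) = ∅ := card_eq_zero.1 h0
        rw [hemp]
        exact ⟨Eq, eq_equivalence, by simp, by simp⟩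
      have : Nonempty (Fin I.keptCard) := ⟨⟨0, h0⟩⟩
      have hinv := hφ.invOn_invFunOn
      refine ⟨_, h'.comap (Function.invFunOn φ (univ : Finset (Fin I.keptCard)))
        (hφ.symm hinv.symm) fun u hu v hv => ?_⟩
      rw [hadj, hinv.2 hu, hinv.2 hv]
    · rintro ⟨r, h⟩
      have h' := h.comap φ hφ (A' := cadj G) fun i _ j _ => hadj i j
      refine ⟨_, h'.equiv, h'.cost, fun u hu v hv => ?_⟩
      -- Class sizes are at most the number of vertices, so capping `η` there changes nothing.
      have h1 := h'.bal u hu v hv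
      have h2 : #{w | r (φ u) (φ w)} ≤ I.keptCard := by
        simpa using card_le_univ ({w | r (φ u) (φ w)} : Finset (Fin I.keptCard))
      have key : ∀ a b c d : ℕ, a ≤ b + d → a ≤ c → a ≤ b + min c d := by omega
      exact key _ _ _ _ h1 h2

theorem kernel_bound (I : Instance) : I.kernel.n ≤ 100 * (I.k + 1) ^ 3 ∧ I.kernel.k ≤ I.k ∧
    I.kernel.η ≤ 100 * (I.k + 1) ^ 3 := by
  by_cases hI : I.Rejected
  · have : 0 < (I.k + 1) ^ 3 := by positivity
    simp only [kernel, hI, if_true]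
    omega
  · have := keptCard_le hI
    simp only [kernel, hI, if_false]
    omega

end Kernel

end Instance

end BalancedCluster

/-! ### Counted loops -/

namespace RAM

/-- A loop that maintains an invariant and whose test succeeds exactly in its first `B` rounds. -/
theorem exec_loop {e : Expr} {body : Prog} (Inv : ℕ → State → Prop) (B T : ℕ)
    (htest : ∀ i s, i ≤ B → Inv i s → (e.eval s ≠ 0 ↔ i < B))
    (hbody : ∀ i s, i < B → Inv i s → ∃ t s', Exec body s t s' ∧ t ≤ T ∧ Inv (i + 1) s')
    {s : State} (h0 : Inv 0 s) :
    ∃ t s', Exec (.loop e body) s t s' ∧ t ≤ (B + 1) * (T + e.cost + 1) ∧ Inv B s' := by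
  have key : ∀ m i s, i + m = B → Inv i s →
      ∃ t s', Exec (.loop e body) s t s' ∧ t ≤ (m + 1) * (T + e.cost + 1) ∧ Inv B s' := by
    intro m
    induction m with
    | zero =>
      intro i s hi h
      obtain rfl : i = B := by omega
      have h0 : e.eval s = 0 := by
        by_contra hne
        exact absurd ((htest i s le_rfl h).1 hne) (lt_irrefl i)
      exact ⟨_, s, .loop_false body h0, by omega, h⟩
    | succ m ih =>
      intro i s hi h
      obtain ⟨t, s', h1, h2, h3⟩ := hbody i s (by omega) h
      obtain ⟨t', s'', h4, h5, h6⟩ := ih (i + 1) s' (by omega) h3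
      refine ⟨_, s'', .loop_true ((htest i s (by omega) h).2 (by omega)) h1 h4, ?_, h6⟩
      have : (m + 1 + 1) * (T + e.cost + 1) = (m + 1) * (T + e.cost + 1) + (T + e.cost + 1) := by
        ring
      omega
  exact key B 0 s (by omega) h0

theorem State.setReg_reg (s : State) (x v y : ℕ) :
    (s.setReg x v).reg y = if y = x then v else s.reg y := by
  simp [State.setReg, Function.update_apply]

@[simp] theorem State.setReg_arr (s : State) (x v : ℕ) : (s.setReg x v).arr = s.arr := rfl

@[simp] theorem State.setArr_reg (s : State) (a i v : ℕ) : (s.setArr a i v).reg = s.reg := rfl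

theorem State.setArr_arr (s : State) (a i v b j : ℕ) :
    (s.setArr a i v).arr b j = if b = a ∧ j = i then v else s.arr b j := by
  by_cases hb : b = a
  · subst hb
    simp [State.setArr, Function.update_apply]
  · simp [State.setArr, hb]

end RAM

/-! ### Functions computable in polynomial time -/

/-!
The kernel is defined by counting and by quantifying over vertices. The predicate `Computable` says
that a function of an instance and some variables is evaluated by a program that leaves the
input and the variables in place; it is closed under these operations. -/

namespace BalancedCluster

open Finset Classical RAM Polynomial

/-- A context: an instance and `m` variables, all depending on a parameter. -/
structure Ctx (α : Type) where
  /-- the instance -/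
  inst : α → Instance
  /-- the number of variables -/
  m : ℕ
  /-- the values of the variables -/
  env : α → ℕ → ℕ

namespace Ctx

variable {α : Type} (Γ : Ctx α)

/-- The configuration `s` contains the instance and, from register `3` on, the variables. -/
structure Holds (a : α) (s : State) : Prop where
  reg_zero : s.reg 0 = (Γ.inst a).n
  reg_one : s.reg 1 = (Γ.inst a).k
  reg_two : s.reg 2 = (Γ.inst a).η
  arr_zero : s.arr 0 = (Γ.inst a).init.arr 0
  var : ∀ i < Γ.m, s.reg (3 + i) = Γ.env a i

/-- The extension of a context by a variable that ranges over the vertices. -/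
abbrev push : Ctx (Σ a, Fin (Γ.inst a).n) where
  inst b := Γ.inst b.1
  m := Γ.m + 1
  env b i := if i = Γ.m then (b.2 : ℕ) else Γ.env b.1 i

variable {Γ}

theorem Holds.congr {a : α} {s s' : State} (h : Γ.Holds a s) {d : ℕ} (hd : Γ.m + 3 ≤ d)
    (hr : ∀ x < d, s'.reg x = s.reg x) (ha : s'.arr 0 = s.arr 0) : Γ.Holds a s' where
  reg_zero := by rw [hr 0 (by omega), h.reg_zero]
  reg_one := by rw [hr 1 (by omega), h.reg_one]
  reg_two := by rw [hr 2 (by omega), h.reg_two]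
  arr_zero := by rw [ha, h.arr_zero]
  var i hi := by rw [hr (3 + i) (by omega), h.var i hi]

theorem Holds.of_push {b : Σ a, Fin (Γ.inst a).n} {s : State} (h : Γ.push.Holds b s) :
    Γ.Holds b.1 s where
  reg_zero := h.reg_zero
  reg_one := h.reg_one
  reg_two := h.reg_two
  arr_zero := h.arr_zero
  var i hi := by
    rw [h.var i (Nat.lt_succ_of_lt hi)]
    exact if_neg hi.ne

end Ctx

/-- The program `P` evaluates `f` in at most `T` steps, where `T` depends on the number of vertices:
it leaves the value in register `d`, and it changes neither the registers
below `d` nor the arrays. -/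
def Evaluates {α : Type} (Γ : Ctx α) (f : α → ℕ) (T : ℕ[X]) (d : ℕ) (P : Prog) : Prop :=
  ∀ a s, Γ.Holds a s → ∃ t s', Exec P s t s' ∧ t ≤ T.eval (Γ.inst a).n ∧ s'.reg d = f a ∧
    (∀ x < d, s'.reg x = s.reg x) ∧ s'.arr = s.arr

/-- A function of the instance and the variables is computable in polynomial time. The
register for the result may be any that is beyond the variables. -/
def Computable {α : Type} (Γ : Ctx α) (f : α → ℕ) : Prop :=
  ∃ T : ℕ[X], ∀ d, Γ.m + 3 ≤ d → ∃ P, Evaluates Γ f T d P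

/-- A predicate of the instance and the variables is decidable in polynomial time. -/
def Decides {α : Type} (Γ : Ctx α) (p : α → Prop) : Prop :=
  Computable Γ fun a => if p a then 1 else 0

section Closure

variable {α : Type} {Γ : Ctx α} {f g : α → ℕ} {p q : α → Prop}

theorem Computable.of_expr (e : Expr)
    (h : ∀ a s, Γ.Holds a s → e.eval s = f a) : Computable Γ f := by
  refine ⟨C (e.cost + 1), fun d _ => ⟨.assign d e, fun a s hs => ?_⟩⟩
  refine ⟨_, _, .assign d e s, by simp, ?_, fun x hx => ?_, rfl⟩
  · rw [State.setReg_reg, if_pos rfl, h a s hs]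
  · rw [State.setReg_reg, if_neg hx.ne]

theorem computable_const (c : ℕ) : Computable Γ fun _ => c :=
  .of_expr (.const c) fun _ _ _ => rfl

theorem computable_k : Computable Γ fun a => (Γ.inst a).k :=
  .of_expr (.reg 1) fun _ _ h => h.reg_one

theorem computable_eta : Computable Γ fun a => (Γ.inst a).η :=
  .of_expr (.reg 2) fun _ _ h => h.reg_two

theorem computable_var {i : ℕ} (hi : i < Γ.m) : Computable Γ fun a => Γ.env a i :=
  .of_expr (.reg (3 + i)) fun _ _ h => h.var i hi

theorem Computable.congr (h : Computable Γ f) (e : ∀ a, f a = g a) : Computable Γ g :=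
  funext e ▸ h

theorem Computable.weaken (h : Computable Γ f) : Computable Γ.push fun b => f b.1 := by
  obtain ⟨T, h⟩ := h
  refine ⟨T, fun d hd => ?_⟩
  obtain ⟨P, hP⟩ := h d (by simp only at hd; omega)
  exact ⟨P, fun b s hs => hP b.1 s hs.of_push⟩

theorem Computable.load (h : Computable Γ f) :
    Computable Γ fun a => (Γ.inst a).init.arr 0 (f a) := by
  obtain ⟨T, h⟩ := h
  refine ⟨T + 3, fun d hd => ?_⟩
  obtain ⟨P, hP⟩ := h d hd
  refine ⟨.seq P (.assign d (.load 0 (.reg d))), fun a s hs => ?_⟩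
  obtain ⟨t, s', h1, h2, h3, h4, h5⟩ := hP a s hs
  refine ⟨_, _, .seq h1 (.assign _ _ _), ?_, ?_, fun x hx => ?_, h5⟩
  · rw [eval_add]
    exact Nat.add_le_add h2 (by simp [Expr.cost])
  · rw [State.setReg_reg, if_pos rfl]
    simp only [Expr.eval, h3, h5, hs.arr_zero]
  · rw [State.setReg_reg, if_neg hx.ne, h4 x hx]

theorem Computable.binary (op : Expr → Expr → Expr) (F : ℕ → ℕ → ℕ)
    (heval : ∀ s e e', (op e e').eval s = F (e.eval s) (e'.eval s))
    (hcost : ∀ x y, (op (.reg x) (.reg y)).cost = 3)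
    (hf : Computable Γ f) (hg : Computable Γ g) : Computable Γ fun a => F (f a) (g a) := by
  obtain ⟨T, hf⟩ := hf
  obtain ⟨T', hg⟩ := hg
  refine ⟨T + (T' + 4), fun d hd => ?_⟩
  obtain ⟨P, hP⟩ := hf d hd
  obtain ⟨Q, hQ⟩ := hg (d + 1) (by omega)
  refine ⟨.seq P (.seq Q (.assign d (op (.reg d) (.reg (d + 1))))), fun a s hs => ?_⟩
  obtain ⟨t, s', h1, h2, h3, h4, h5⟩ := hP a s hs
  obtain ⟨t', s'', h1', h2', h3', h4', h5'⟩ := hQ a s' (hs.congr hd h4 (by rw [h5]))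
  refine ⟨_, _, .seq h1 (.seq h1' (.assign _ _ _)), ?_, ?_, fun x hx => ?_, h5'.trans h5⟩
  · rw [eval_add, eval_add, hcost]
    exact Nat.add_le_add h2 (Nat.add_le_add h2' (by simp))
  · rw [State.setReg_reg, if_pos rfl, heval]
    simp only [Expr.eval, h3', h4' d (by omega), h3]
  · rw [State.setReg_reg, if_neg hx.ne, h4' x (by omega), h4 x hx]

theorem Computable.add (hf : Computable Γ f) (hg : Computable Γ g) :
    Computable Γ fun a => f a + g a :=
  .binary .add (· + ·) (fun _ _ _ => rfl) (fun _ _ => rfl) hf hg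

theorem Computable.sub (hf : Computable Γ f) (hg : Computable Γ g) :
    Computable Γ fun a => f a - g a :=
  .binary .sub (· - ·) (fun _ _ _ => rfl) (fun _ _ => rfl) hf hg

theorem Decides.le (hf : Computable Γ f) (hg : Computable Γ g) :
    Decides Γ fun a => f a ≤ g a := by
  refine (Computable.binary .le (fun x y => if x ≤ y then 1 else 0) (fun _ _ _ => rfl)
    (fun _ _ => rfl) hf hg).congr fun a => ?_
  congr

theorem Computable.ite [∀ a, Decidable (p a)] (hp : Decides Γ p) (hf : Computable Γ f)
    (hg : Computable Γ g) : Computable Γ fun a => if p a then f a else g a := by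
  obtain ⟨T, hp⟩ := hp
  obtain ⟨T₁, hf⟩ := hf
  obtain ⟨T₂, hg⟩ := hg
  refine ⟨T + (2 + (T₁ + T₂)), fun d hd => ?_⟩
  obtain ⟨P, hP⟩ := hp d hd
  obtain ⟨P₁, hP₁⟩ := hf d hd
  obtain ⟨P₂, hP₂⟩ := hg d hd
  refine ⟨.seq P (.cond (.reg d) P₁ P₂), fun a s hs => ?_⟩
  obtain ⟨t, s', h1, h2, h3, h4, h5⟩ := hP a s hs
  have hs' := hs.congr hd h4 (by rw [h5])
  by_cases ha : p a
  · obtain ⟨t', s'', h1', h2', h3', h4', h5'⟩ := hP₁ a s' hs'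
    refine ⟨_, _, .seq h1 (.cond_true _ ?_ h1'), ?_, ?_, fun x hx => ?_, h5'.trans h5⟩
    · simp [Expr.eval, h3, ha]
    · simp only [eval_add, Expr.cost, eval_ofNat]
      omega
    · simp only [h3', if_pos ha]
    · rw [h4' x hx, h4 x hx]
  · obtain ⟨t', s'', h1', h2', h3', h4', h5'⟩ := hP₂ a s' hs'
    refine ⟨_, _, .seq h1 (.cond_false _ ?_ h1'), ?_, ?_, fun x hx => ?_, h5'.trans h5⟩
    · simp [Expr.eval, h3, ha]
    · simp only [eval_add, Expr.cost, eval_ofNat]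
      omega
    · simp only [h3', if_neg ha]
    · rw [h4' x hx, h4 x hx]

/-- Sums over the vertices are computed by a loop. The loop variable takes the register of the
new variable of the extended context, whose content is saved and restored. -/
theorem Computable.sum {f : ∀ a, Fin (Γ.inst a).n → ℕ}
    (h : Computable Γ.push fun b => f b.1 b.2) : Computable Γ fun a => ∑ i, f a i := by
  obtain ⟨T, h⟩ := h
  refine ⟨6 + ((X + 1) * ((T + 8) + 5 + 1) + 4), fun d hd => ?_⟩
  obtain ⟨P, hP⟩ := h (d + 3) (by simp only; omega)
  set x := 3 + Γ.m with hx
  refine ⟨.seq (.seq (.assign (d + 2) (.reg x)) (.seq (.assign (d + 1) (.const 0))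
    (.assign x (.const 0)))) (.seq (.loop (.le (.add (.reg x) (.const 1)) (.reg 0))
      (.seq P (.seq (.assign (d + 1) (.add (.reg (d + 1)) (.reg (d + 3))))
        (.assign x (.add (.reg x) (.const 1))))))
      (.seq (.assign x (.reg (d + 2))) (.assign d (.reg (d + 1))))), fun a s hs => ?_⟩
  set F : ℕ → ℕ := fun i => if hi : i < (Γ.inst a).n then f a ⟨i, hi⟩ else 0 with hF
  let Inv : ℕ → State → Prop := fun i s' => s'.reg x = i ∧ s'.reg (d + 1) = ∑ j ∈ range i, F j ∧
    s'.reg (d + 2) = s.reg x ∧ (∀ y < d, y ≠ x → s'.reg y = s.reg y) ∧ s'.arr = s.arr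
  have hloop := exec_loop (e := .le (.add (.reg x) (.const 1)) (.reg 0))
    (body := .seq P (.seq (.assign (d + 1) (.add (.reg (d + 1)) (.reg (d + 3))))
        (.assign x (.add (.reg x) (.const 1)))))
    Inv (Γ.inst a).n (T.eval (Γ.inst a).n + 8) ?_ ?_
    (s := ((s.setReg (d + 2) (s.reg x)).setReg (d + 1) 0).setReg x 0) ?_
  · obtain ⟨t, s', h1, h2, h3, h4, h5, h6, h7⟩ := hloop
    refine ⟨_, _, .seq (.seq (.assign _ _ _) (.seq (.assign _ _ _) (.assign _ _ _)))
      (.seq h1 (.seq (.assign _ _ _) (.assign _ _ _))), ?_, ?_, fun y hy => ?_, h7⟩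
    · simp only [Expr.cost, eval_add, eval_mul, eval_X, eval_ofNat, eval_one,
        Nat.reduceAdd] at h2 ⊢
      omega
    · simp only [Expr.eval, State.setReg_reg, if_true]
      rw [if_neg (by omega), h4, Finset.sum_range]
      exact sum_congr rfl fun i _ => dif_pos i.2
    · simp only [Expr.eval, State.setReg_reg]
      rw [if_neg hy.ne]
      split_ifs with hyx
      · rw [h5, hyx]
      · exact h6 y hy hyx
  · rintro i s' hi ⟨h3, h4, h5, h6, h7⟩
    simp only [Expr.eval, h3, h6 0 (by omega) (by omega), hs.reg_zero]
    split_ifs <;> simp <;> omega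
  · rintro i s' hi ⟨h3, h4, h5, h6, h7⟩
    have hs' : Γ.push.Holds ⟨a, ⟨i, hi⟩⟩ s' :=
      { reg_zero := by rw [h6 0 (by omega) (by omega), hs.reg_zero]
        reg_one := by rw [h6 1 (by omega) (by omega), hs.reg_one]
        reg_two := by rw [h6 2 (by omega) (by omega), hs.reg_two]
        arr_zero := by rw [h7, hs.arr_zero]
        var := by
          intro j hj
          by_cases hjm : j = Γ.m
          · subst hjm
            simp only [if_true]
            exact h3
          · simp only [if_neg hjm]
            simp only at hj
            rw [h6 (3 + j) (by omega) (by omega), hs.var j (by omega)] }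
    obtain ⟨t, s'', g1, g2, g3, g4, g5⟩ := hP _ s' hs'
    refine ⟨_, _, .seq g1 (.seq (.assign _ _ _) (.assign _ _ _)), ?_, ?_⟩
    · simp only [Expr.cost]
      simp only at g2
      omega
    · simp only at g3
      simp only [Inv, Expr.eval, State.setReg_reg, State.setReg_arr, if_true]
      refine ⟨?_, ?_, ?_, fun y hy hyx => ?_, g5.trans h7⟩
      · rw [if_neg (by omega), g4 x (by omega), h3]
      · rw [if_neg (by omega), g3, g4 (d + 1) (by omega), h4, sum_range_succ]
        simp only [hF, dif_pos hi]
      · rw [if_neg (by omega), if_neg (by omega), g4 (d + 2) (by omega), h5]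
      · rw [if_neg hyx, if_neg (by omega), g4 y (by omega), h6 y hy hyx]
  · simp only [Inv, State.setReg_reg, State.setReg_arr, if_true, range_zero, sum_empty, and_true]
    refine ⟨trivial, by simp, ?_, fun y hy hyx => ?_⟩
    · rw [if_neg (by omega), if_neg (by omega)]
    · rw [if_neg hyx, if_neg (by omega), if_neg (by omega)]

theorem Decides.congr (h : Decides Γ p) (e : ∀ a, p a ↔ q a) : Decides Γ q :=
  (funext fun a => propext (e a) : p = q) ▸ h

theorem Decides.and (hp : Decides Γ p) (hq : Decides Γ q) : Decides Γ fun a => p a ∧ q a :=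
  (Computable.ite hp hq (computable_const 0)).congr fun a => by
    by_cases h : p a <;> by_cases h' : q a <;> simp [h, h']

theorem Decides.not (hp : Decides Γ p) : Decides Γ fun a => ¬ p a :=
  (Computable.ite hp (computable_const 0) (computable_const 1)).congr fun a => by
    by_cases h : p a <;> simp [h]

theorem Decides.or (hp : Decides Γ p) (hq : Decides Γ q) : Decides Γ fun a => p a ∨ q a :=
  (Computable.ite hp (computable_const 1) hq).congr fun a => by
    by_cases h : p a <;> by_cases h' : q a <;> simp [h, h']

theorem Decides.imp (hp : Decides Γ p) (hq : Decides Γ q) : Decides Γ fun a => p a → q a :=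
  (hp.not.or hq).congr fun _ => imp_iff_not_or.symm

theorem Decides.iff (hp : Decides Γ p) (hq : Decides Γ q) : Decides Γ fun a => (p a ↔ q a) :=
  ((hp.imp hq).and (hq.imp hp)).congr fun _ => iff_def.symm

theorem Decides.lt (hf : Computable Γ f) (hg : Computable Γ g) : Decides Γ fun a => f a < g a :=
  Decides.le (hf.add (computable_const 1)) hg

theorem Decides.eq (hf : Computable Γ f) (hg : Computable Γ g) : Decides Γ fun a => f a = g a :=
  ((Decides.le hf hg).and (Decides.le hg hf)).congr fun _ => le_antisymm_iff.symm

theorem Computable.card {p : ∀ a, Fin (Γ.inst a).n → Prop} [∀ a, DecidablePred (p a)]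
    (h : Decides Γ.push fun b => p b.1 b.2) : Computable Γ fun a => #{i | p a i} :=
  (Computable.sum (f := fun a i => @_root_.ite _ (p a i) (propDecidable _) 1 0) h).congr fun a => by
    rw [card_filter]
    exact sum_congr rfl fun i _ => by congr

theorem Decides.exists {p : ∀ a, Fin (Γ.inst a).n → Prop}
    (h : Decides Γ.push fun b => p b.1 b.2) : Decides Γ fun a => ∃ i, p a i :=
  (Decides.le (computable_const 1) (Computable.card h)).congr fun a => by
    rw [Nat.succ_le_iff, card_pos]
    exact ⟨fun ⟨i, hi⟩ => ⟨i, (mem_filter.1 hi).2⟩,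
      fun ⟨i, hi⟩ => ⟨i, mem_filter.2 ⟨mem_univ i, hi⟩⟩⟩

theorem Decides.forall {p : ∀ a, Fin (Γ.inst a).n → Prop}
    (h : Decides Γ.push fun b => p b.1 b.2) : Decides Γ fun a => ∀ i, p a i :=
  (Decides.exists (p := fun a i => ¬ p a i) h.not).not.congr fun a => by simp

end Closure

end BalancedCluster

namespace BalancedCluster

open Finset Classical RAM Polynomial

/-! ### The kernel is computable -/

section KernelComputable

variable {α : Type} {Γ : Ctx α} {u v : ∀ a, Fin (Γ.inst a).n}

/-- The new variable of an extended context. -/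
theorem computable_last : Computable Γ.push fun b => (b.2 : ℕ) :=
  (computable_var (Γ := Γ.push) (i := Γ.m) (Nat.lt_succ_self _)).congr fun _ => if_pos rfl

theorem Computable.const_mul {f : α → ℕ} (c : ℕ) (hf : Computable Γ f) :
    Computable Γ fun a => c * f a := by
  induction c with
  | zero => exact (computable_const 0).congr fun a => (Nat.zero_mul _).symm
  | succ c ih => exact (ih.add hf).congr fun a => (Nat.succ_mul _ _).symm

theorem Instance.init_arr_zero (I : Instance) (u v : Fin I.n) :
    I.init.arr 0 ((u : ℕ) * I.n + v) = if I.graph.Adj u v then 1 else 0 := by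
  have h : (∃ u' v' : Fin I.n, (u : ℕ) * I.n + v = u' * I.n + v' ∧ I.graph.Adj u' v') ↔
      I.graph.Adj u v := by
    refine ⟨?_, fun h => ⟨u, v, rfl, h⟩⟩
    rintro ⟨u', v', e, h⟩
    have hn : 0 < I.n := u.pos
    have hv : (v : ℕ) = v' := by
      have := congrArg (· % I.n) e
      simpa [Nat.add_mod, Nat.mod_eq_of_lt] using this
    have hu : (u : ℕ) = u' := by
      rw [hv] at e
      exact Nat.eq_of_mul_eq_mul_right hn (Nat.add_right_cancel e)
    rwa [Fin.ext hu, Fin.ext hv]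
  simp only [Instance.init, true_and, h]

theorem decides_adj (hu : Computable Γ fun a => (u a : ℕ)) (hv : Computable Γ fun a => (v a : ℕ)) :
    Decides Γ fun a => (Γ.inst a).graph.Adj (u a) (v a) := by
  have hmul : Computable Γ fun a => ∑ _i : Fin (Γ.inst a).n, (u a : ℕ) :=
    Computable.sum (f := fun a _ => (u a : ℕ)) hu.weaken
  refine (hmul.add hv).load.congr fun a => ?_
  rw [sum_const, card_univ, Fintype.card_fin, smul_eq_mul, mul_comm, Instance.init_arr_zero]

theorem decides_fin_eq (hu : Computable Γ fun a => (u a : ℕ))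
    (hv : Computable Γ fun a => (v a : ℕ)) : Decides Γ fun a => u a = v a :=
  (Decides.eq hu hv).congr fun _ => Fin.ext_iff.symm

theorem decides_fin_lt (hu : Computable Γ fun a => (u a : ℕ))
    (hv : Computable Γ fun a => (v a : ℕ)) : Decides Γ fun a => u a < v a :=
  Decides.lt hu hv

theorem decides_fin_le (hu : Computable Γ fun a => (u a : ℕ))
    (hv : Computable Γ fun a => (v a : ℕ)) : Decides Γ fun a => u a ≤ v a :=
  Decides.le hu hv

theorem decides_cadj (hu : Computable Γ fun a => (u a : ℕ))
    (hv : Computable Γ fun a => (v a : ℕ)) :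
    Decides Γ fun a => cadj (Γ.inst a).graph (u a) (v a) :=
  (decides_fin_eq hu hv).or (decides_adj hu hv)

theorem decides_twin (hu : Computable Γ fun a => (u a : ℕ))
    (hv : Computable Γ fun a => (v a : ℕ)) : Decides Γ fun a => (Γ.inst a).Twin (u a) (v a) :=
  Decides.forall ((decides_cadj hu.weaken computable_last).iff
    (decides_cadj hv.weaken computable_last))

theorem decides_big (hv : Computable Γ fun a => (v a : ℕ)) :
    Decides Γ fun a => (Γ.inst a).Big (v a) :=
  Decides.lt (.const_mul 2 computable_k) (Computable.card (decides_twin computable_last hv.weaken))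

theorem decides_forced (hu : Computable Γ fun a => (u a : ℕ)) :
    Decides Γ fun a => (Γ.inst a).Forced (u a) :=
  Decides.exists ((decides_big computable_last).and (decides_cadj computable_last hu.weaken))

theorem decides_nadj (hu : Computable Γ fun a => (u a : ℕ))
    (hv : Computable Γ fun a => (v a : ℕ)) : Decides Γ fun a => (Γ.inst a).Nadj (u a) (v a) :=
  (((decides_forced hu).or (decides_forced hv)).and (Decides.exists
    ((decides_big computable_last).and ((decides_cadj computable_last hu.weaken).and
      (decides_cadj computable_last hv.weaken))))).or
    (((decides_forced hu).or (decides_forced hv)).not.and (decides_cadj hu hv))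

theorem computable_defect : Computable Γ fun a => (Γ.inst a).defect :=
  Computable.sum (Computable.card ((decides_fin_lt computable_last.weaken computable_last).and
    ((decides_cadj computable_last.weaken computable_last).iff
      (decides_nadj computable_last.weaken computable_last)).not))

theorem computable_sz (hu : Computable Γ fun a => (u a : ℕ)) :
    Computable Γ fun a => (Γ.inst a).sz (u a) :=
  Computable.card (decides_nadj hu.weaken computable_last)

theorem decides_clean (hu : Computable Γ fun a => (u a : ℕ)) :
    Decides Γ fun a => (Γ.inst a).Clean (u a) :=
  Decides.forall ((decides_nadj hu.weaken computable_last).imp (Decides.forall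
    ((decides_nadj computable_last.weaken computable_last).iff
      (decides_nadj hu.weaken.weaken computable_last))))

theorem decides_large (hu : Computable Γ fun a => (u a : ℕ)) :
    Decides Γ fun a => (Γ.inst a).Large (u a) :=
  (decides_clean hu).and (Decides.lt (.const_mul 4 computable_k) (computable_sz hu))

theorem decides_top (hu : Computable Γ fun a => (u a : ℕ)) :
    Decides Γ fun a => (Γ.inst a).Top (u a) :=
  (decides_large hu).and (Decides.forall ((decides_large computable_last).imp
    (Decides.le (computable_sz computable_last) (computable_sz hu.weaken))))

theorem decides_lead (hu : Computable Γ fun a => (u a : ℕ)) :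
    Decides Γ fun a => (Γ.inst a).Lead (u a) :=
  (decides_top hu).and (Decides.forall ((decides_top computable_last).imp
    (decides_fin_le hu.weaken computable_last)))

theorem decides_hasSmall : Decides Γ fun a => (Γ.inst a).HasSmall :=
  Decides.exists (decides_large computable_last).not

theorem computable_maxSize : Computable Γ fun a => (Γ.inst a).maxSize :=
  Computable.sum (Computable.ite (decides_lead computable_last) (computable_sz computable_last)
    (computable_const 0))

theorem decides_marked (hu : Computable Γ fun a => (u a : ℕ)) :
    Decides Γ fun a => (Γ.inst a).Marked (u a) :=
  (decides_clean hu).and ((Decides.le (computable_sz hu) (.const_mul 4 computable_k)).and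
    (Decides.le (Computable.card ((decides_fin_lt computable_last hu.weaken).and
      ((decides_clean computable_last).and
        (Decides.eq (computable_sz computable_last) (computable_sz hu.weaken)))))
      (.const_mul 2 computable_k)))

theorem decides_inTop (hu : Computable Γ fun a => (u a : ℕ)) :
    Decides Γ fun a => (Γ.inst a).InTop (u a) :=
  decides_hasSmall.and (Decides.exists ((decides_lead computable_last).and
    ((decides_nadj computable_last hu.weaken).and
      (Decides.le (Computable.card ((decides_fin_lt computable_last hu.weaken.weaken).and
        (decides_nadj computable_last.weaken computable_last))) (.const_mul 4 computable_k)))))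

theorem decides_kept (hu : Computable Γ fun a => (u a : ℕ)) :
    Decides Γ fun a => (Γ.inst a).Kept (u a) :=
  (decides_clean hu).not.or ((Decides.exists ((decides_marked computable_last).and
    (decides_nadj hu.weaken computable_last))).or (decides_inTop hu))

theorem decides_rejected : Decides Γ fun a => (Γ.inst a).Rejected :=
  (Decides.lt computable_k computable_defect).or
    ((Decides.lt (Computable.sum (Computable.ite (Decides.lt computable_last computable_k)
      (.const_mul 8 computable_k) (computable_const 0)))
      (Computable.card (decides_clean computable_last).not)).or
    ((Decides.exists (Decides.exists ((decides_large computable_last.weaken).and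
      ((decides_large computable_last).and
        (Decides.lt ((computable_sz computable_last).add computable_eta)
          (computable_sz computable_last.weaken)))))).or
    (decides_hasSmall.and (Decides.exists ((decides_lead computable_last).and
      (Decides.lt (computable_eta.add ((Computable.const_mul 4 computable_k).add
        (computable_const 1))) (computable_sz computable_last)))))))

theorem computable_shrunkEta : Computable Γ fun a => (Γ.inst a).shrunkEta :=
  computable_eta.sub (computable_maxSize.sub
    ((Computable.const_mul 4 computable_k).add (computable_const 1)))

theorem computable_keptCard : Computable Γ fun a => (Γ.inst a).keptCard :=
  Computable.card (decides_kept computable_last)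

theorem computable_pos (hu : Computable Γ fun a => (u a : ℕ)) :
    Computable Γ fun a => (Γ.inst a).pos (u a) :=
  Computable.card ((decides_kept computable_last).and
    (decides_fin_lt computable_last hu.weaken))

theorem decides_outAdj {f g : α → ℕ} (hf : Computable Γ f) (hg : Computable Γ g) :
    Decides Γ fun a => (Γ.inst a).OutAdj (f a) (g a) :=
  (Decides.eq hf hg).not.and ((decides_rejected.and
    ((Decides.eq hf (computable_const 1)).or (Decides.eq hg (computable_const 1)))).or
    (decides_rejected.not.and (Decides.exists (Decides.exists
      ((decides_kept computable_last.weaken).and ((decides_kept computable_last).and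
        ((Decides.eq (computable_pos computable_last.weaken) hf.weaken.weaken).and
          ((Decides.eq (computable_pos computable_last) hg.weaken.weaken).and
            (decides_nadj computable_last.weaken computable_last)))))))))

theorem computable_kernel_n : Computable Γ fun a => (Γ.inst a).kernel.n :=
  Computable.ite decides_rejected (computable_const 3) computable_keptCard

theorem computable_kernel_k : Computable Γ fun a => (Γ.inst a).kernel.k :=
  Computable.ite decides_rejected (computable_const 0) (computable_k.sub computable_defect)

theorem computable_kernel_eta : Computable Γ fun a => (Γ.inst a).kernel.η :=
  Computable.ite decides_rejected (computable_const 0)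
    ((Computable.ite (Decides.le computable_keptCard computable_shrunkEta)
      computable_keptCard computable_shrunkEta).congr fun _ => (min_def _ _).symm)

end KernelComputable

end BalancedCluster

namespace BalancedCluster

open Finset Classical RAM Polynomial

/-! ### The kernelization program -/

theorem eval_mono (T : ℕ[X]) {x y : ℕ} (h : x ≤ y) : T.eval x ≤ T.eval y := by
  rw [eval_eq_sum, eval_eq_sum]
  exact Finset.sum_le_sum fun i _ => Nat.mul_le_mul_left _ (Nat.pow_le_pow_left h i)

/-- An instance and two further numbers as variables. -/
abbrev indexCtx : Ctx (Instance × ℕ × ℕ) where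
  inst a := a.1
  m := 2
  env a i := if i = 0 then a.2.1 else a.2.2

/-- Cell `c` of the adjacency matrix of the output, stored row by row. -/
noncomputable def outCell (I : Instance) (c : ℕ) : ℕ :=
  if I.OutAdj (c / I.kernel.n) (c % I.kernel.n) then 1 else 0

/-- The configuration during the output phase: the input is in place, registers `5`, `6`, `7`
contain the numbers of the output, and the first `c` cells of its matrix are in
array `1`, where `c` is the content of register `8`. -/
structure Writing (I : Instance) (c : ℕ) (s : State) : Prop where
  reg_zero : s.reg 0 = I.n
  reg_one : s.reg 1 = I.k
  reg_two : s.reg 2 = I.η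
  reg_five : s.reg 5 = I.kernel.n
  reg_six : s.reg 6 = I.kernel.k
  reg_seven : s.reg 7 = I.kernel.η
  reg_eight : s.reg 8 = c
  arr_zero : s.arr 0 = I.init.arr 0
  arr_one : ∀ x < c, s.arr 1 x = outCell I x

theorem Writing.congr {I : Instance} {c : ℕ} {s s' : State} (h : Writing I c s)
    (hr : ∀ x < 9, x ≠ 3 → x ≠ 4 → s'.reg x = s.reg x) (ha : s'.arr = s.arr) :
    Writing I c s' where
  reg_zero := by rw [hr 0 (by omega) (by omega) (by omega), h.reg_zero]
  reg_one := by rw [hr 1 (by omega) (by omega) (by omega), h.reg_one]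
  reg_two := by rw [hr 2 (by omega) (by omega) (by omega), h.reg_two]
  reg_five := by rw [hr 5 (by omega) (by omega) (by omega), h.reg_five]
  reg_six := by rw [hr 6 (by omega) (by omega) (by omega), h.reg_six]
  reg_seven := by rw [hr 7 (by omega) (by omega) (by omega), h.reg_seven]
  reg_eight := by rw [hr 8 (by omega) (by omega) (by omega), h.reg_eight]
  arr_zero := by rw [ha, h.arr_zero]
  arr_one x hx := by rw [ha, h.arr_one x hx]

theorem Writing.holds {I : Instance} {c : ℕ} {s : State} (h : Writing I c s) :
    indexCtx.Holds (I, s.reg 3, s.reg 4) s where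
  reg_zero := h.reg_zero
  reg_one := h.reg_one
  reg_two := h.reg_two
  arr_zero := h.arr_zero
  var i hi := by
    have hi2 : i < 2 := hi
    interval_cases i <;> simp

/-- Adds the cell with row and column in registers `3` and `4` to array `1`; the program
`P` evaluates it. -/
def writeCell (P : Prog) : Prog :=
  .seq P (.seq (.store 1 (.reg 8) (.reg 9)) (.seq (.assign 8 (.add (.reg 8) (.const 1)))
    (.assign 4 (.add (.reg 4) (.const 1)))))

/-- Adds to array `1` the row whose number is in register `3`. -/
def writeRow (P : Prog) : Prog :=
  .seq (.assign 4 (.const 0)) (.seq (.loop (.le (.add (.reg 4) (.const 1)) (.reg 5)) (writeCell P))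
    (.assign 3 (.add (.reg 3) (.const 1))))

/-- Copies cell number `i` of array `1` to array `0`, where `i` is the content of register `3`. -/
def copyCell : Prog :=
  .seq (.store 0 (.reg 3) (.load 1 (.reg 3))) (.assign 3 (.add (.reg 3) (.const 1)))

section Output

variable {T : ℕ[X]} {P : Prog} {I : Instance}

theorem exec_writeCell
    (hP : Evaluates indexCtx (fun a => if a.1.OutAdj a.2.1 a.2.2 then 1 else 0) T 9 P)
    {i j : ℕ} (hj : j < I.kernel.n) {s : State} (h : Writing I (i * I.kernel.n + j) s)
    (h3 : s.reg 3 = i) (h4 : s.reg 4 = j) :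
    ∃ t s', Exec (writeCell P) s t s' ∧ t ≤ T.eval I.n + 11 ∧
      Writing I (i * I.kernel.n + (j + 1)) s' ∧ s'.reg 3 = i ∧ s'.reg 4 = j + 1 := by
  obtain ⟨t, s', e1, e2, e3, e4, e5⟩ := hP _ s h.holds
  have hcell : s'.reg 9 = outCell I (i * I.kernel.n + j) := by
    have hd : (i * I.kernel.n + j) / I.kernel.n = i := by
      rw [mul_comm, Nat.mul_add_div (by omega), Nat.div_eq_of_lt hj, add_zero]
    have hm : (i * I.kernel.n + j) % I.kernel.n = j := by
      rw [mul_comm, Nat.mul_add_mod, Nat.mod_eq_of_lt hj]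
    rw [e3, h3, h4, outCell, hd, hm]
  have h' := h.congr (s' := s') (fun x hx _ _ => e4 x hx) e5
  refine ⟨_, _, .seq e1 (.seq (.store _ _ _ _) (.seq (.assign _ _ _) (.assign _ _ _))), ?_, ?_,
    ?_, ?_⟩
  · simp only [Expr.cost]
    simp only at e2
    omega
  · constructor <;>
      simp only [State.setReg_reg, State.setReg_arr, State.setArr_reg, State.setArr_arr, Expr.eval]
    · simpa using h'.reg_zero
    · simpa using h'.reg_one
    · simpa using h'.reg_two
    · simpa using h'.reg_five
    · simpa using h'.reg_six
    · simpa using h'.reg_seven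
    · simp [h'.reg_eight, add_assoc]
    · funext x
      simp [State.setArr_arr, h'.arr_zero]
    · intro x hx
      rw [h'.reg_eight]
      by_cases hxe : x = i * I.kernel.n + j
      · rw [if_pos ⟨trivial, hxe⟩, hcell, hxe]
      · rw [if_neg fun h => hxe h.2, h'.arr_one x (by omega)]
  · simp [State.setReg_reg, Expr.eval, e4, h3]
  · simp [State.setReg_reg, Expr.eval, e4, h4]

theorem exec_writeRow
    (hP : Evaluates indexCtx (fun a => if a.1.OutAdj a.2.1 a.2.2 then 1 else 0) T 9 P)
    {i : ℕ} {s : State} (h : Writing I (i * I.kernel.n) s) (h3 : s.reg 3 = i) :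
    ∃ t s', Exec (writeRow P) s t s' ∧
      t ≤ (I.kernel.n + 1) * (T.eval I.n + 17) + 6 ∧
      Writing I ((i + 1) * I.kernel.n) s' ∧ s'.reg 3 = i + 1 := by
  have hloop := exec_loop (e := .le (.add (.reg 4) (.const 1)) (.reg 5)) (body := writeCell P)
    (fun j s => Writing I (i * I.kernel.n + j) s ∧ s.reg 3 = i ∧ s.reg 4 = j) I.kernel.n
    (T.eval I.n + 11) ?_ (fun j s hj h => exec_writeCell hP hj h.1 h.2.1 h.2.2)
    (s := s.setReg 4 0) ?_
  · obtain ⟨t, s', e1, e2, e3, e4, -⟩ := hloop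
    refine ⟨_, _, .seq (.assign _ _ _) (.seq e1 (.assign _ _ _)), ?_, ?_, ?_⟩
    · simp only [Expr.cost, Nat.reduceAdd, add_assoc] at e2 ⊢
      omega
    · rw [Nat.succ_mul]
      exact e3.congr (fun x _ hx3 _ => by rw [State.setReg_reg, if_neg hx3]) rfl
    · simp [State.setReg_reg, Expr.eval, e4]
  · rintro j s - ⟨h, -, h4⟩
    simp only [Expr.eval, h4, h.reg_five]
    split_ifs <;> simp <;> omega
  · refine ⟨h.congr (fun x _ _ hx4 => by rw [State.setReg_reg, if_neg hx4]) rfl, ?_, ?_⟩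
    · simp [State.setReg_reg, h3]
    · simp [State.setReg_reg]

theorem exec_writeRows
    (hP : Evaluates indexCtx (fun a => if a.1.OutAdj a.2.1 a.2.2 then 1 else 0) T 9 P)
    {s : State} (h : Writing I 0 s) (h3 : s.reg 3 = 0) :
    ∃ t s', Exec (.loop (.le (.add (.reg 3) (.const 1)) (.reg 5)) (writeRow P)) s t s' ∧
      t ≤ (I.kernel.n + 1) * ((I.kernel.n + 1) * (T.eval I.n + 17) + 12) ∧
      Writing I (I.kernel.n * I.kernel.n) s' := by
  obtain ⟨t, s', e1, e2, e3, -⟩ := exec_loop (e := .le (.add (.reg 3) (.const 1)) (.reg 5))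
    (body := writeRow P) (fun i s => Writing I (i * I.kernel.n) s ∧ s.reg 3 = i) I.kernel.n
    ((I.kernel.n + 1) * (T.eval I.n + 17) + 6)
    (by
      rintro i s - ⟨h, h3⟩
      simp only [Expr.eval, h3, h.reg_five]
      split_ifs <;> simp <;> omega)
    (fun i s _ h => exec_writeRow hP h.1 h.2) (s := s) ⟨by rwa [zero_mul], h3⟩
  exact ⟨t, s', e1, e2, e3⟩

theorem exec_copy {c : ℕ} {s : State} (h : Writing I c s) (h3 : s.reg 3 = 0) :
    ∃ t s', Exec (.loop (.le (.add (.reg 3) (.const 1)) (.reg 8)) copyCell) s t s' ∧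
      t ≤ (c + 1) * 14 ∧ s'.reg 5 = I.kernel.n ∧ s'.reg 6 = I.kernel.k ∧
      s'.reg 7 = I.kernel.η ∧ ∀ x < c, s'.arr 0 x = outCell I x := by
  obtain ⟨t, s', e1, e2, e3, e4, -, e5⟩ := exec_loop
    (e := .le (.add (.reg 3) (.const 1)) (.reg 8)) (body := copyCell)
    (fun i s' => s'.reg 3 = i ∧ (∀ x, x ≠ 3 → s'.reg x = s.reg x) ∧ s'.arr 1 = s.arr 1 ∧
      ∀ x < i, s'.arr 0 x = outCell I x) c 8
    (by
      rintro i s' - ⟨h3, hr, -⟩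
      simp only [Expr.eval, h3, hr 8 (by omega), h.reg_eight]
      split_ifs <;> simp <;> omega)
    (by
      rintro i s' hi ⟨h3, hr, h1, h0⟩
      refine ⟨_, _, .seq (.store _ _ _ _) (.assign _ _ _), by simp [Expr.cost], ?_, ?_, ?_, ?_⟩
      · simp [State.setReg_reg, Expr.eval, h3]
      · intro x hx
        rw [State.setReg_reg, if_neg hx]
        exact hr x hx
      · funext x
        simp [State.setArr_arr, h1]
      · intro x hx
        simp only [State.setReg_arr, State.setArr_arr, Expr.eval, h3, h1, true_and]
        split_ifs with hxi
        · rw [h.arr_one i hi, hxi]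
        · exact h0 x (by omega))
    (s := s) ⟨h3, fun _ _ => rfl, rfl, fun x hx => absurd hx (Nat.not_lt_zero x)⟩
  refine ⟨t, s', e1, e2, ?_, ?_, ?_, e5⟩
  · rw [e4 5 (by omega), h.reg_five]
  · rw [e4 6 (by omega), h.reg_six]
  · rw [e4 7 (by omega), h.reg_seven]

end Output

/-- The program: `P₅`, `P₆`, `P₇` compute the numbers of the output, and `P₉` the cells of its
adjacency matrix. The matrix is collected in array `1`, because the input is needed until
the end. -/
def kernelProg (P₅ P₆ P₇ P₉ : Prog) : Prog :=
  .seq (.seq P₅ (.seq P₆ (.seq P₇ (.seq (.assign 8 (.const 0)) (.assign 3 (.const 0))))))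
    (.seq (.loop (.le (.add (.reg 3) (.const 1)) (.reg 5)) (writeRow P₉))
    (.seq (.assign 3 (.const 0))
    (.seq (.loop (.le (.add (.reg 3) (.const 1)) (.reg 8)) copyCell)
    (.seq (.assign 0 (.reg 5)) (.seq (.assign 1 (.reg 6)) (.assign 2 (.reg 7)))))))

theorem init_holds (I : Instance) : indexCtx.Holds (I, 0, 0) I.init where
  reg_zero := by simp [Instance.init]
  reg_one := by simp [Instance.init]
  reg_two := by simp [Instance.init]
  arr_zero := rfl
  var i hi := by
    have hi2 : i < 2 := hi
    interval_cases i <;> simp [Instance.init]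

theorem kernel_n_le (I : Instance) : I.kernel.n ≤ I.n + 3 := by
  have h : I.keptCard ≤ I.n := (card_le_univ _).trans_eq (Fintype.card_fin _)
  by_cases hI : I.Rejected <;> simp only [Instance.kernel, hI, if_true, if_false] <;> omega

theorem exec_kernelProg {T₅ T₆ T₇ T₉ : ℕ[X]} {P₅ P₆ P₇ P₉ : Prog}
    (h₅ : Evaluates indexCtx (fun a => a.1.kernel.n) T₅ 5 P₅)
    (h₆ : Evaluates indexCtx (fun a => a.1.kernel.k) T₆ 6 P₆)
    (h₇ : Evaluates indexCtx (fun a => a.1.kernel.η) T₇ 7 P₇)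
    (h₉ : Evaluates indexCtx (fun a => if a.1.OutAdj a.2.1 a.2.2 then 1 else 0) T₉ 9 P₉)
    (I : Instance) :
    ∃ t s, Exec (kernelProg P₅ P₆ P₇ P₉) I.init t s ∧
      t ≤ T₅.eval I.n + T₆.eval I.n + T₇.eval I.n + 12 +
        (I.kernel.n + 1) * ((I.kernel.n + 1) * (T₉.eval I.n + 17) + 12) +
        (I.kernel.n * I.kernel.n + 1) * 14 ∧
      I.kernel.StoredIn s := by
  have hinit := init_holds I
  obtain ⟨t₅, s₅, a1, a2, a3, a4, a5⟩ := h₅ _ _ hinit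
  have hs₅ := hinit.congr (s' := s₅) (d := 5) (by simp) a4 (by rw [a5])
  obtain ⟨t₆, s₆, b1, b2, b3, b4, b5⟩ := h₆ _ _ hs₅
  have hs₆ := hs₅.congr (s' := s₆) (d := 5) (by simp) (fun x hx => b4 x (by omega)) (by rw [b5])
  obtain ⟨t₇, s₇, c1, c2, c3, c4, c5⟩ := h₇ _ _ hs₆
  have hs₇ := hs₆.congr (s' := s₇) (d := 5) (by simp) (fun x hx => c4 x (by omega)) (by rw [c5])
  have hw : Writing I 0 ((s₇.setReg 8 0).setReg 3 0) := by
    constructor <;> simp only [State.setReg_reg, State.setReg_arr]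
    · exact hs₇.reg_zero
    · exact hs₇.reg_one
    · exact hs₇.reg_two
    · simp [c4, b4, a3]
    · simp [c4, b3]
    · simp [c3]
    · simp
    · exact hs₇.arr_zero
    · exact fun x hx => absurd hx (Nat.not_lt_zero x)
  obtain ⟨t, s, e1, e2, e3⟩ := exec_writeRows h₉ hw (by simp [State.setReg_reg])
  obtain ⟨t', s', g1, g2, g3, g4, g5, g6⟩ := exec_copy (s := s.setReg 3 0)
    (e3.congr (fun x _ hx3 _ => by rw [State.setReg_reg, if_neg hx3]) rfl)
    (by simp [State.setReg_reg])
  refine ⟨_, _, .seq (.seq a1 (.seq b1 (.seq c1 (.seq (.assign _ _ _) (.assign _ _ _)))))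
    (.seq e1 (.seq (.assign _ _ _) (.seq g1 (.seq (.assign _ _ _) (.seq (.assign _ _ _)
      (.assign _ _ _)))))), ?_, ?_, ?_, ?_, fun u v => ?_⟩
  · simp only [Expr.cost] at a2 b2 c2 ⊢
    omega
  · simp [State.setReg_reg, Expr.eval, g3]
  · simp [State.setReg_reg, Expr.eval, g4]
  · simp [State.setReg_reg, Expr.eval, g5]
  · have hlt : (u : ℕ) * I.kernel.n + v < I.kernel.n * I.kernel.n := by
      calc (u : ℕ) * I.kernel.n + v < u * I.kernel.n + I.kernel.n := Nat.add_lt_add_left v.2 _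
        _ = (u + 1) * I.kernel.n := (Nat.succ_mul _ _).symm
        _ ≤ I.kernel.n * I.kernel.n := Nat.mul_le_mul_right _ u.2
    have hd : ((u : ℕ) * I.kernel.n + v) / I.kernel.n = u := by
      rw [mul_comm, Nat.mul_add_div u.pos, Nat.div_eq_of_lt v.2, add_zero]
    have hm : ((u : ℕ) * I.kernel.n + v) % I.kernel.n = v := by
      rw [mul_comm, Nat.mul_add_mod, Nat.mod_eq_of_lt v.2]
    have hcell := g6 _ hlt
    simp only [outCell, hd, hm] at hcell
    simp only [State.setReg_arr, hcell]
    exact ⟨fun h => if_pos h, fun h => if_neg h⟩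

theorem exists_isPolyTimeReduction :
    ∃ P, IsPolyTimeReduction P fun I J => J = I.kernel := by
  obtain ⟨T₅, h₅⟩ := computable_kernel_n (Γ := indexCtx)
  obtain ⟨T₆, h₆⟩ := computable_kernel_k (Γ := indexCtx)
  obtain ⟨T₇, h₇⟩ := computable_kernel_eta (Γ := indexCtx)
  obtain ⟨T₉, h₉⟩ := decides_outAdj (Γ := indexCtx) (f := fun a => a.2.1) (g := fun a => a.2.2)
    ((computable_var (Γ := indexCtx) (i := 0) (by simp)).congr fun _ => rfl)
    ((computable_var (Γ := indexCtx) (i := 1) (by simp)).congr fun _ => rfl)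
  obtain ⟨P₅, h₅⟩ := h₅ 5 le_rfl
  obtain ⟨P₆, h₆⟩ := h₆ 6 (by simp)
  obtain ⟨P₇, h₇⟩ := h₇ 7 (by simp)
  obtain ⟨P₉, h₉⟩ := h₉ 9 (by simp)
  refine ⟨kernelProg P₅ P₆ P₇ P₉, T₅ + T₆ + T₇ + 12 + (X + 4) * ((X + 4) * (T₉ + 17) + 12) +
    ((X + 3) * (X + 3) + 1) * 14, fun I => ?_⟩
  obtain ⟨t, s, h1, h2, h3⟩ := exec_kernelProg h₅ h₆ h₇ h₉ I
  refine ⟨I.kernel, t, s, h1, ?_, h3, I.kernel_isYes_iff, rfl⟩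
  have hn : I.n ≤ I.size := by
    have : I.n ≤ I.n ^ 2 := Nat.le_self_pow two_ne_zero _
    unfold Instance.size
    omega
  refine le_trans (h2.trans ?_) (eval_mono _ hn)
  simp only [eval_add, eval_mul, eval_X, eval_ofNat, eval_one]
  have hk := kernel_n_le I
  have hk' : I.kernel.n + 1 ≤ I.n + 4 := by omega
  gcongr

end BalancedCluster

theorem mainTheorem3 :
    ∃ C : ℕ, BalancedCluster.AdmitsKernel (fun k => C * (k + 1) ^ 3) := by
  obtain ⟨P, p, h⟩ := BalancedCluster.exists_isPolyTimeReduction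
  refine ⟨100, P, p, fun I => ?_⟩
  obtain ⟨J, t, s, h1, h2, h3, h4, rfl⟩ := h I
  exact ⟨_, t, s, h1, h2, h3, h4, I.kernel_bound⟩
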